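/- Conventions. A hyperbolic space is a geodesic metric space which is $\delta$-hyperbolic for some $\delta$ (not necessarily proper), with Gromov boundary $\partial X$. A $(K,\epsilon)$ quasi-isometric embedding $q:X\to Y$ satisfies $\frac1K d(x,y)-\epsilon\le d(q(x),q(y))\le K d(x,y)+\epsilon$, where $K\ge 1$, $\epsilon\ge 0$; it is a $(K,\epsilon,C)$ quasi-isometry if moreover every point of $Y$ is within $C$ of its image. A quasi-action of a group $G$ on a metric space $X$ is a map $\alpha:G\times X\to X$ such that, for some fixed $K,\epsilon,C$, every $\alpha(g,\cdot)$ is a $(K,\epsilon,C)$ quasi-isometry of $X$, $d(\alpha(1,x),x)\le C$ and $d(\alpha(g,\alpha(h,x)),\alpha(gh,x))\le C$ for all $g,h,x$; it is cobounded if some quasi-orbit $\{\alpha(g,x_0) : g\in G\}$ is coarse dense. A map $F$ from a quasi-action $\beta$ on $Y$ to $\alpha$ on $X$ is coarse $G$-equivariant if $d(F(\beta(g,y)),\alpha(g,F(y)))$ is bounded over all $g,y$. The quasi-action $\alpha$ reduces to $\beta$ if there is a coarse $G$-equivariant quasi-isometric embedding from $\beta$ to $\alpha$, and $\alpha,\beta$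 are equivalent if there is a coarse $G$-equivariant quasi-isometry from one to the other. An isometric action of $G$ on a hyperbolic space $X$ is lineal, or of type (3), if its limit set $\partial_G X\subseteq\partial X$ (the boundary points that are limits of sequences in an orbit) has exactly two points; it is of type (3)$^+$ if $G$ fixes both limit points and of type (3)$^-$ otherwise. The subgroup $G^+$ of elements fixing both limit points is the orientation preserving subgroup. A quasi-morphism on a group $H$ is a function $f:H\to\mathbb R$ with $|f(gh)-f(g)-f(h)|$ bounded; it is homogeneous if $f(g^n)=nf(g)$ for all $g\in H$, $n\in\mathbb Z$. If $H$ acts isometrically on $X$ fixing $\zeta\in\partial X$, and $(x_n)$ is a sequence in $X$ tending to $\zeta$, the Busemann quasi-morphism of $H$ at $\zeta$ is the homogeneous quasi-morphism within bounded distance of $g\mapsto\liminf_{n}\big(d(x_n,x_0)-d(x_n,gx_0)\big)$. The Busemann quasi-morphism of a lineal action of $G$ is that of $G$ for type (3)$^+$, and that of $G^+$ for type (3)$^-$, at either of the two limit points. For an index $2$ subgroup $H$ of $G$, a homogeneous quasi-morphism $q$ of $H$ is antisymmetric in $G$ if $q(tht^{-1})=-q(h)$ for all $h\in H$, $t\in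 G\setminus H$. Statement. (0) For every group acting isometrically on a hyperbolic space and fixing a boundary point $\zeta$, the Busemann quasi-morphism at $\zeta$ exists and is unique. (1) Let $\alpha$ be a quasi-action of a group $G$ on a metric space, and suppose that $\alpha$ reduces to two isometric actions $\beta,\gamma$ of type (3) on hyperbolic spaces (not necessarily the same space). Then either both $\beta$ and $\gamma$ are of type (3)$^+$, or both are of type (3)$^-$ with the same orientation preserving subgroup, which has index $2$ in $G$. In either case the homogeneous Busemann quasi-morphisms are related by scaling: $B_\beta=c\,B_\gamma$ for some real $c\neq 0$, whichever limit points are used to define them. (2) Let $G$ be a group. Sending an action to the projective class of its Busemann quasi-morphism gives a well defined bijection from the cobounded lineal isometric actions of $G$ on hyperbolic spaces, up to equivalence, to the disjoint union of the projective space of the vector space of homogeneous quasi-morphisms of $G$ (for the actions of type (3)$^+$) and, over all index $2$ subgroups $H$ of $G$, the projective spaces of the vector spaces of homogeneous quasi-morphisms of $H$ that are antisymmetric in $G$ (for the actions of type (3)$^-$ with $G^+=H$). -/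

import Mathlib

open Filter

universe u v v' w

/-! Quasi-isometric embeddings, quasi-actions, reductions -/

section Coarse

variable {X : Type*} {Y : Type*} [MetricSpace X] [MetricSpace Y]

/-- `F` is a `(K, ε)` quasi-isometric embedding. -/
def IsQIEmbeddingWith (K ε : ℝ) (F : X → Y) : Prop :=
  1 ≤ K ∧ 0 ≤ ε ∧ ∀ x y : X,
    (1 / K) * dist x y - ε ≤ dist (F x) (F y) ∧ dist (F x) (F y) ≤ K * dist x y + ε

/-- `F` is a `(K, ε, C)` quasi-isometry: a `(K, ε)` quasi-isometric embedding
that is `C`-coarse onto. -/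
def IsQuasiIsometryWith (K ε C : ℝ) (F : X → Y) : Prop :=
  IsQIEmbeddingWith K ε F ∧ 0 ≤ C ∧ ∀ y : Y, ∃ x : X, dist (F x) y ≤ C

variable {G : Type*} [Group G]

/-- `α` is a quasi-action of the group `G` on the metric space `X`. -/
def IsQuasiAction (α : G → X → X) : Prop :=
  ∃ K ε C : ℝ, (∀ g : G, IsQuasiIsometryWith K ε C (α g)) ∧
    (∀ x : X, dist (α 1 x) x ≤ C) ∧
    ∀ (x : X) (g h : G), dist (α g (α h x)) (α (g * h) x) ≤ C

/-- A map `F` is coarse `G`-equivariant from `α` to `β`. -/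
def IsCoarseEquivariant (α : G → X → X) (β : G → Y → Y) (F : X → Y) : Prop :=
  ∃ M : ℝ, 0 ≤ M ∧ ∀ (x : X) (g : G), dist (F (α g x)) (β g (F x)) ≤ M

/-- The quasi-action `α` on `X` reduces to the quasi-action `β` on `Y`: there is a coarse
`G`-equivariant quasi-isometric embedding from `β` to `α`. -/
def ReducesTo (α : G → X → X) (β : G → Y → Y) : Prop :=
  ∃ F : Y → X, (∃ K ε : ℝ, IsQIEmbeddingWith K ε F) ∧ IsCoarseEquivariant β α F

/-- The quasi-actions `α` and `β` are equivalent: there is a coarse `G`-equivariant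
quasi-isometry from one to the other. -/
def AreEquivalent (α : G → X → X) (β : G → Y → Y) : Prop :=
  ∃ F : X → Y, (∃ K ε C : ℝ, IsQuasiIsometryWith K ε C F) ∧ IsCoarseEquivariant α β F

/-- The quasi-action `α` is cobounded: some quasi-orbit is coarse dense. -/
def IsCobounded (α : G → X → X) : Prop :=
  ∃ (x₀ : X) (C : ℝ), ∀ x : X, ∃ g : G, dist (α g x₀) x ≤ C

end Coarse

/-! Hyperbolic spaces and the Gromov boundary -/

/-- The Gromov product of `x` and `y` based at `w`. -/
noncomputable def gromovProduct {X : Type*} [MetricSpace X] (x y w : X) : ℝ :=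
  (dist x w + dist y w - dist x y) / 2

/-- A hyperbolic space: a geodesic metric space that is `δ`-hyperbolic for some `δ`.
No properness is assumed. -/
class HyperbolicSpace (X : Type*) [MetricSpace X] : Prop where
  geodesic : ∀ x y : X, ∃ c : ℝ → X, c 0 = x ∧ c (dist x y) = y ∧
    ∀ s ∈ Set.Icc 0 (dist x y), ∀ t ∈ Set.Icc 0 (dist x y), dist (c s) (c t) = |s - t|
  hyperbolic : ∃ δ : ℝ, ∀ x y z w : X,
    min (gromovProduct x y w) (gromovProduct y z w) - δ ≤ gromovProduct x z w

section Boundary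

variable {X : Type*} [MetricSpace X]

/-- `(x_i | y_j)_w → ∞` as `i, j → ∞`, for every base point `w`. -/
def GromovClose (x y : ℕ → X) : Prop :=
  ∀ w : X, Tendsto (fun p : ℕ × ℕ => gromovProduct (x p.1) (y p.2) w) atTop atTop

theorem gromovProduct_comm (x y w : X) : gromovProduct x y w = gromovProduct y x w := by
  simp only [gromovProduct, dist_comm x y]; ring

theorem GromovClose.symm {x y : ℕ → X} (h : GromovClose x y) : GromovClose y x := by
  intro w
  have h1 := h w
  rw [← prod_atTop_atTop_eq] at h1 ⊢
  refine (h1.comp (tendsto_prod_swap)).congr ?_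
  intro p
  exact gromovProduct_comm _ _ _

theorem GromovClose.trans [HyperbolicSpace X] {x y z : ℕ → X}
    (h : GromovClose x y) (h' : GromovClose y z) : GromovClose x z := by
  obtain ⟨δ, hδ⟩ := HyperbolicSpace.hyperbolic (X := X)
  intro w
  rw [tendsto_atTop]
  intro R
  obtain ⟨a, ha⟩ := eventually_atTop.1 (tendsto_atTop.1 (h w) (R + δ))
  obtain ⟨b, hb⟩ := eventually_atTop.1 (tendsto_atTop.1 (h' w) (R + δ))
  refine eventually_atTop.2 ⟨(a.1, b.2), fun p hp => ?_⟩
  have h1 := ha (p.1, max a.2 b.1) ⟨hp.1, le_max_left _ _⟩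
  have h2 := hb (max a.2 b.1, p.2) ⟨le_max_right _ _, hp.2⟩
  have h3 := hδ (x p.1) (y (max a.2 b.1)) (z p.2) w
  have h4 := le_min h1 h2
  simp only at h4
  linarith

variable (X) in
/-- Sequences converging to infinity. -/
def GromovSeq : Type _ := {x : ℕ → X // GromovClose x x}

/-- Two sequences converging to infinity are equivalent when their mutual Gromov products
tend to infinity. -/
instance gromovSetoid [HyperbolicSpace X] : Setoid (GromovSeq X) where
  r x y := GromovClose x.1 y.1
  iseqv := ⟨fun x => x.2, fun h => h.symm, fun h h' => h.trans h'⟩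

variable (X) in
/-- The Gromov boundary. -/
def GromovBoundary [HyperbolicSpace X] : Type _ := Quotient (gromovSetoid (X := X))

/-- The sequence `x` of points of `X` tends to the boundary point `ζ`. -/
def TendsToBoundary [HyperbolicSpace X] (x : ℕ → X) (ζ : GromovBoundary X) : Prop :=
  ∃ hx : GromovClose x x, ζ = Quotient.mk gromovSetoid ⟨x, hx⟩

variable {G : Type*} [Group G] [MulAction G X] [IsIsometricSMul G X]

theorem GromovClose.smul {x y : ℕ → X} (h : GromovClose x y) (g : G) :
    GromovClose (fun n => g • x n) (fun n => g • y n) := by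
  intro w
  refine (h (g⁻¹ • w)).congr ?_
  intro p
  have key : ∀ a : X, dist (g • a) w = dist a (g⁻¹ • w) := fun a => by
    rw [← dist_smul g a (g⁻¹ • w), smul_inv_smul]
  simp only [gromovProduct, dist_smul, key]

/-- The action on the boundary induced by an isometric action. -/
instance boundaryAction [HyperbolicSpace X] : MulAction G (GromovBoundary X) where
  smul g := Quotient.map (fun x : GromovSeq X => (⟨fun n => g • x.1 n, x.2.smul g⟩ : GromovSeq X))
    (fun _ _ h => GromovClose.smul h g)
  one_smul ζ := by
    induction ζ using Quotient.inductionOn with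
    | h x =>
      refine congrArg (Quotient.mk _) (Subtype.ext ?_)
      funext n
      exact one_smul G (x.1 n)
  mul_smul g h ζ := by
    induction ζ using Quotient.inductionOn with
    | h x =>
      refine congrArg (Quotient.mk _) (Subtype.ext ?_)
      funext n
      exact mul_smul g h (x.1 n)

end Boundary

section Lineal

variable (G X : Type*) [Group G] [MetricSpace X] [HyperbolicSpace X] [MulAction G X]

/-- The limit set: boundary points that are limits of sequences in an orbit. -/
def limitSet : Set (GromovBoundary X) :=
  {ζ | ∃ (x₀ : X) (u : ℕ → G), TendsToBoundary (fun n => u n • x₀) ζ}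

/-- Type (3) actions: the limit set has exactly two points. -/
def IsLineal : Prop := (limitSet G X).encard = 2

/-- The subgroup of elements fixing both limit points. -/
def orientationSubgroup [IsIsometricSMul G X] : Subgroup G :=
  fixingSubgroup G (limitSet G X)

/-- Type (3)⁺ actions: lineal, with both limit points fixed by `G`. -/
def IsLinealPlus [IsIsometricSMul G X] : Prop :=
  IsLineal G X ∧ ∀ ζ ∈ limitSet G X, ∀ g : G, g • ζ = ζ

/-- Type (3)⁻ actions: lineal, with the limit points not all fixed by `G`. -/
def IsLinealMinus [IsIsometricSMul G X] : Prop :=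
  IsLineal G X ∧ ¬ ∀ ζ ∈ limitSet G X, ∀ g : G, g • ζ = ζ

end Lineal

/-! Homogeneous quasi-morphisms -/

/-- `q` is a homogeneous quasi-morphism. -/
def IsHomogeneousQuasimorphism {G : Type*} [Group G] (q : G → ℝ) : Prop :=
  (∃ D : ℝ, ∀ g h : G, |q (g * h) - q g - q h| ≤ D) ∧
    ∀ (g : G) (n : ℤ), q (g ^ n) = n * q g

/-- The vector space of homogeneous quasi-morphisms of `G`. -/
def homogeneousQuasimorphisms (G : Type*) [Group G] : Submodule ℝ (G → ℝ) where
  carrier := {q | IsHomogeneousQuasimorphism q}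
  zero_mem' := ⟨⟨0, by simp⟩, by simp⟩
  add_mem' := by
    rintro p q ⟨⟨D, hD⟩, hp⟩ ⟨⟨E, hE⟩, hq⟩
    refine ⟨⟨D + E, fun g h => ?_⟩, fun g n => ?_⟩
    · have h1 := abs_add_le (p (g * h) - p g - p h) (q (g * h) - q g - q h)
      have h2 := hD g h
      have h3 := hE g h
      have h4 : (p + q) (g * h) - (p + q) g - (p + q) h
          = (p (g * h) - p g - p h) + (q (g * h) - q g - q h) := by
        simp only [Pi.add_apply]; ring
      rw [h4]; linarith
    · simp only [Pi.add_apply, hp, hq]; ring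
  smul_mem' := by
    rintro c q ⟨⟨D, hD⟩, hq⟩
    refine ⟨⟨|c| * D, fun g h => ?_⟩, fun g n => ?_⟩
    · have h4 : (c • q) (g * h) - (c • q) g - (c • q) h = c * (q (g * h) - q g - q h) := by
        simp only [Pi.smul_apply, smul_eq_mul]; ring
      rw [h4, abs_mul]
      exact mul_le_mul_of_nonneg_left (hD g h) (abs_nonneg c)
    · simp only [Pi.smul_apply, smul_eq_mul, hq]; ring

/-- For a subgroup `H` of `G`, the vector space of homogeneous quasi-morphisms `q` of `H` that are
antisymmetric in `G`: `q (t h t⁻¹) = - q h` for `h ∈ H` and `t ∈ G \ H`. -/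
def antisymmetricQuasimorphisms {G : Type*} [Group G] (H : Subgroup G) :
    Submodule ℝ (H → ℝ) where
  carrier := {q | q ∈ homogeneousQuasimorphisms H ∧
    ∀ t : G, t ∉ H → ∀ h h' : H, (h' : G) = t * h * t⁻¹ → q h' = - q h}
  zero_mem' := ⟨Submodule.zero_mem _, by simp⟩
  add_mem' := by
    rintro p q ⟨hp, hp'⟩ ⟨hq, hq'⟩
    refine ⟨Submodule.add_mem _ hp hq, fun t ht h h' e => ?_⟩
    simp only [Pi.add_apply, hp' t ht h h' e, hq' t ht h h' e]; ring
  smul_mem' := by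
    rintro c q ⟨hq, hq'⟩
    refine ⟨Submodule.smul_mem _ c hq, fun t ht h h' e => ?_⟩
    simp only [Pi.smul_apply, smul_eq_mul, hq' t ht h h' e]; ring

/-! Busemann quasi-morphisms -/

section Busemann

variable {X : Type*} [MetricSpace X]

/-- The quasi-horofunction of a sequence of points. -/
noncomputable def quasiHorofunction (x : ℕ → X) (z : X) : ℝ :=
  liminf (fun n => dist (x n) (x 0) - dist (x n) z) atTop

variable [HyperbolicSpace X]

/-- `B` is the Busemann quasi-morphism at `ζ` of the action of `H` on `X` (which is meant to fix
`ζ`): it is the homogenisation of `g ↦ η_x (g x_0)` for a sequence `x` tending to `ζ`, that is, a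
homogeneous quasi-morphism within bounded distance of it. -/
def IsBusemannAt {H : Type*} [Group H] [MulAction H X] (ζ : GromovBoundary X) (B : H → ℝ) :
    Prop :=
  IsHomogeneousQuasimorphism B ∧ ∃ x : ℕ → X, TendsToBoundary x ζ ∧
    ∃ C : ℝ, ∀ g : H, |quasiHorofunction x (g • x 0) - B g| ≤ C

end Busemann

/-- An isometric action of `G` on a hyperbolic space. -/
structure HyperbolicAction (G : Type u) [Group G] : Type (max u v + 1) where
  space : Type (max u v)
  [metric : MetricSpace space]
  [action : MulAction G space]
  [isometric : IsIsometricSMul G space]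
  [hyp : HyperbolicSpace space]

attribute [instance] HyperbolicAction.metric HyperbolicAction.action
  HyperbolicAction.isometric HyperbolicAction.hyp

/-- The cobounded lineal isometric actions of `G` on hyperbolic spaces. -/
def CoboundedLinealAction (G : Type u) [Group G] : Type (max u v + 1) :=
  {A : HyperbolicAction.{u, v} G //
    IsCobounded (fun (g : G) (x : A.space) => g • x) ∧ IsLineal G A.space}

/-- The disjoint union of the projective space of homogeneous quasi-morphisms of `G` and of the
projective spaces of homogeneous quasi-morphisms of `H` antisymmetric in `G`, over all subgroups
`H` of index two. -/
abbrev ProjectiveQuasimorphisms (G : Type u) [Group G] : Type u :=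
  Projectivization ℝ (homogeneousQuasimorphisms G) ⊕
    (Σ H : {H : Subgroup G // H.index = 2}, Projectivization ℝ (antisymmetricQuasimorphisms H.1))

/-! Homogeneous quasi-morphisms -/

/-! Everything rests on one estimate: if a group fixes two distinct boundary points, the
displacement `dist w (g • w)` equals `|B g|` up to a bounded error, where `B` is the Busemann
quasi-morphism at either point (`exists_abs_dist_sub_abs_busemann_le`). A lineal action is therefore
determined, at the level of orbits, by `|B|` on its orientation subgroup, which has index at most 2.

The second ingredient is rigidity: if `|p| ≤ M |q| + C` for homogeneous quasi-morphisms with `q ≠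
0`, then `p` is a multiple of `q` (`IsHomogeneousQuasimorphism.exists_eq_mul`). Two actions to which
one quasi-action reduces have displacements that dominate each other coarsely, so their Busemann
quasi-morphisms are proportional once the orientation subgroups agree. These do agree: if `t` fixes
the ends of one line and swaps those of the other, the commutators of `t` with powers of a
translating element have bounded displacement in the first space and linearly growing displacement
in the second (`orientationSubgroup_le`).

For the classification, proportional quasi-morphisms give comparable orbits, and cobounded actions
with comparable orbits are equivalent; conversely, an equivalence is a special case of two
reductions of one quasi-action. For surjectivity, a homogeneous quasi-morphism, or an antisymmetric
one extended to a sign-twisted quasi-cocycle on `G`, is realised on a `QuasiLine`: a convex set of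
functions on `G` with the sup metric, on which `G` acts by signed translation. Evaluation at 1
identifies it with the real line up to bounded error, and convexity makes it geodesic. -/

theorem eq_zero_of_forall_nat_mul_abs_le {a C : ℝ} (h : ∀ n : ℕ, n * |a| ≤ C) : a = 0 := by
  by_contra ha
  have hpos : 0 < |a| := abs_pos.2 ha
  obtain ⟨n, hn⟩ := exists_nat_gt (C / |a|)
  rw [div_lt_iff₀ hpos] at hn
  exact absurd (h n) (not_le.2 hn)

namespace IsHomogeneousQuasimorphism

variable {H K : Type*} [Group H] [Group K] {p q : H → ℝ}

theorem map_npow (hq : IsHomogeneousQuasimorphism q) (g : H) (n : ℕ) : q (g ^ n) = n * q g := by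
  simpa using hq.2 g n

theorem map_inv (hq : IsHomogeneousQuasimorphism q) (g : H) : q g⁻¹ = -q g := by
  simpa using hq.2 g (-1)

theorem eq_of_bounded (hp : IsHomogeneousQuasimorphism p) (hq : IsHomogeneousQuasimorphism q)
    {C : ℝ} (h : ∀ g, |p g - q g| ≤ C) : p = q := by
  funext g
  refine sub_eq_zero.1 (eq_zero_of_forall_nat_mul_abs_le (C := C) fun n => ?_)
  have := h (g ^ n)
  rwa [hp.map_npow, hq.map_npow, ← mul_sub, abs_mul, Nat.abs_cast] at this

theorem comp (hq : IsHomogeneousQuasimorphism q) (φ : K →* H) :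
    IsHomogeneousQuasimorphism (fun k => q (φ k)) := by
  obtain ⟨⟨D, hD⟩, h⟩ := hq
  exact ⟨⟨D, fun g k => by simpa using hD (φ g) (φ k)⟩, fun g n => by simpa using h (φ g) n⟩

theorem neg (hq : IsHomogeneousQuasimorphism q) : IsHomogeneousQuasimorphism (fun g => -q g) :=
  (homogeneousQuasimorphisms H).neg_mem hq

/-- A homogeneous quasi-morphism that is coarsely dominated by another one is a multiple of it. -/
theorem exists_eq_mul (hp : IsHomogeneousQuasimorphism p) (hq : IsHomogeneousQuasimorphism q)
    {M C : ℝ} (hM : 0 ≤ M) (h : ∀ g, |p g| ≤ M * |q g| + C) {a : H} (ha : q a ≠ 0) :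
    ∃ c : ℝ, ∀ g, p g = c * q g := by
  obtain ⟨⟨D, hD⟩, -⟩ := id hp
  obtain ⟨⟨E, hE⟩, -⟩ := id hq
  set c := p a / q a with hc
  have hpa : p a = c * q a := by rw [hc]; field_simp
  refine ⟨c, fun g => sub_eq_zero.1 (eq_zero_of_forall_nat_mul_abs_le
    (C := D + (M * (E + |q a|) + C) + |c| * (|q a|)) fun n => ?_)⟩
  -- Rounding `n * q g / q a` gives a power of `a` that cancels `q (g ^ n)` up to `|q a|`.
  -- Domination then bounds `p (g ^ n * a ^ m)` independently of `n`, which bounds `n * |p g - c * q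
  -- g|`.
  obtain ⟨m, hm⟩ : ∃ m : ℤ, |n * q g + m * q a| ≤ |q a| := by
    refine ⟨-round (n * q g / q a), ?_⟩
    have h1 := abs_sub_round (n * q g / q a)
    have h2 : n * q g + ((-round (n * q g / q a) : ℤ) : ℝ) * q a
        = (n * q g / q a - round (n * q g / q a)) * q a := by
      push_cast; field_simp; ring
    rw [h2, abs_mul]
    nlinarith [abs_nonneg (q a)]
  have h1 := hD (g ^ n) (a ^ m)
  have h2 := hE (g ^ n) (a ^ m)
  have h3 := h (g ^ n * a ^ m)
  rw [hp.map_npow, hp.2] at h1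
  rw [hq.map_npow, hq.2] at h2
  have h4 : |q (g ^ n * a ^ m)| ≤ E + |q a| := by
    have := abs_add_le (q (g ^ n * a ^ m) - n * q g - m * q a) (n * q g + m * q a)
    rw [show q (g ^ n * a ^ m) - n * q g - m * q a + (n * q g + m * q a)
      = q (g ^ n * a ^ m) by ring] at this
    linarith
  have h5 : |p (g ^ n * a ^ m)| ≤ M * (E + |q a|) + C :=
    h3.trans (by gcongr)
  have h6 : (n : ℝ) * (p g - c * q g) = -(p (g ^ n * a ^ m) - n * p g - m * p a)
      + p (g ^ n * a ^ m) - c * (n * q g + m * q a) := by rw [hpa]; ring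
  rw [← Nat.abs_cast n, ← abs_mul, h6]
  have h7 := abs_sub (-(p (g ^ n * a ^ m) - n * p g - m * p a) + p (g ^ n * a ^ m))
    (c * (n * q g + m * q a))
  have h8 := abs_add_le (-(p (g ^ n * a ^ m) - n * p g - m * p a)) (p (g ^ n * a ^ m))
  rw [abs_neg] at h8
  have h9 : |c * (n * q g + m * q a)| ≤ |c| * |q a| := by
    rw [abs_mul]; gcongr
  linarith

end IsHomogeneousQuasimorphism

/-! ### Homogenisation of quasi-morphisms -/

section Homogenisation

variable {H : Type*} [Group H] {f : H → ℝ} {D : ℝ}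

theorem abs_pow_sub_le (hf : ∀ g h, |f (g * h) - f g - f h| ≤ D) (g : H) (n : ℕ) :
    |f (g ^ n) - n * f g| ≤ (n + 1) * D := by
  induction n with
  | zero =>
    have := hf 1 1
    simp only [mul_one, sub_self, zero_sub, abs_neg] at this
    simpa using this
  | succ n ih =>
    have h1 := hf (g ^ n) g
    rw [← pow_succ] at h1
    have h2 := abs_add_le (f (g ^ (n + 1)) - f (g ^ n) - f g) (f (g ^ n) - n * f g)
    rw [show f (g ^ (n + 1)) - f (g ^ n) - f g + (f (g ^ n) - n * f g)
      = f (g ^ (n + 1)) - ((n + 1 : ℕ) : ℝ) * f g by push_cast; ring] at h2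
    push_cast at h2 ⊢
    linarith

/-- Adding the defect `D` makes `n ↦ f (g ^ n)` subadditive, so Fekete's lemma applies; the added
constant disappears after division by `n`. -/
theorem exists_tendsto_pow_div (hf : ∀ g h, |f (g * h) - f g - f h| ≤ D) (g : H) :
    ∃ L : ℝ, Tendsto (fun n : ℕ => f (g ^ n) / n) atTop (nhds L) := by
  have hD : 0 ≤ D := (abs_nonneg _).trans (hf 1 1)
  have hsub : Subadditive (fun n : ℕ => f (g ^ n) + D) := fun m n => by
    have := (abs_le.1 (hf (g ^ m) (g ^ n))).2
    rw [← pow_add] at this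
    linarith
  have hbdd : BddBelow (Set.range fun n : ℕ => (f (g ^ n) + D) / n) := by
    refine ⟨-(|f g| + D), ?_⟩
    rintro _ ⟨n, rfl⟩
    rcases Nat.eq_zero_or_pos n with rfl | hn
    · simp only [Nat.cast_zero, div_zero]
      linarith [abs_nonneg (f g)]
    · have hn' : (0 : ℝ) < n := by exact_mod_cast hn
      have h1 := (abs_le.1 (abs_pow_sub_le hf g n)).1
      have h2 := neg_abs_le (f g)
      simp only
      rw [le_div_iff₀ hn']
      nlinarith
  refine ⟨hsub.lim, ?_⟩
  have h1 := hsub.tendsto_lim hbdd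
  have h2 : Tendsto (fun n : ℕ => D / n) atTop (nhds 0) := tendsto_const_div_atTop_nhds_zero_nat D
  have h3 := h1.sub h2
  rw [sub_zero] at h3
  refine h3.congr fun n => ?_
  rw [← sub_div, add_sub_cancel_right]

/-- Every quasi-morphism is within bounded distance of a homogeneous one. -/
theorem exists_homogenisation (hf : ∀ g h, |f (g * h) - f g - f h| ≤ D) :
    ∃ B : H → ℝ, IsHomogeneousQuasimorphism B ∧ ∃ C, ∀ g, |f g - B g| ≤ C := by
  have hD : 0 ≤ D := (abs_nonneg _).trans (hf 1 1)
  choose B hB using exists_tendsto_pow_div hf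
  have hbd : ∀ g, |f g - B g| ≤ 2 * D := fun g => by
    have h1 : Tendsto (fun n : ℕ => |f g - f (g ^ n) / n|) atTop (nhds |f g - B g|) :=
      (tendsto_const_nhds.sub (hB g)).abs
    refine le_of_tendsto h1 (eventually_atTop.2 ⟨1, fun n hn => ?_⟩)
    have hn' : (1 : ℝ) ≤ n := by exact_mod_cast hn
    have h2 := abs_pow_sub_le hf g n
    rw [show f g - f (g ^ n) / n = -(f (g ^ n) - n * f g) / n by field_simp; ring, abs_div,
      abs_neg, Nat.abs_cast, div_le_iff₀ (by linarith)]
    nlinarith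
  -- The limit for `g ^ k` runs along the subsequence of multiples of `k` in the limit for `g`.
  have hpow : ∀ (g : H) (k : ℕ), B (g ^ k) = k * B g := fun g k => by
    refine tendsto_nhds_unique (hB (g ^ k)) ?_
    rcases Nat.eq_zero_or_pos k with rfl | hk
    · simpa using tendsto_const_div_atTop_nhds_zero_nat (f 1)
    · have h1 := ((hB g).comp (tendsto_id.const_mul_atTop' hk)).const_mul (k : ℝ)
      refine h1.congr fun n => ?_
      have hk' : (k : ℝ) ≠ 0 := by exact_mod_cast hk.ne'
      simp only [Function.comp, id, ← pow_mul, Nat.cast_mul]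
      field_simp
  have hinv : ∀ g : H, B g⁻¹ = -B g := fun g => by
    refine tendsto_nhds_unique (hB g⁻¹) ?_
    have h0 : Tendsto (fun n : ℕ => f (g⁻¹ ^ n) / n + f (g ^ n) / n) atTop (nhds 0) := by
      refine squeeze_zero_norm (a := fun n : ℕ => 2 * D / n) (fun n => ?_)
        (tendsto_const_div_atTop_nhds_zero_nat _)
      rw [← add_div, Real.norm_eq_abs, abs_div, Nat.abs_cast]
      gcongr
      have h1 := hf (g⁻¹ ^ n) (g ^ n)
      have h2 := hf 1 1
      rw [inv_pow, inv_mul_cancel] at h1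
      rw [mul_one] at h2
      rw [abs_le] at h1 h2 ⊢
      rw [inv_pow]
      constructor <;> linarith
    have h1 := h0.sub (hB g)
    rw [zero_sub] at h1
    exact h1.congr fun n => by ring
  refine ⟨B, ⟨⟨7 * D, fun g h => ?_⟩, fun g n => ?_⟩, 2 * D, hbd⟩
  · have h1 := abs_le.1 (hf g h)
    have h2 := abs_le.1 (hbd g)
    have h3 := abs_le.1 (hbd h)
    have h4 := abs_le.1 (hbd (g * h))
    rw [abs_le]
    constructor <;> linarith
  · cases n with
    | ofNat n => simpa using hpow g n
    | negSucc n =>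
      rw [zpow_negSucc, hinv, hpow]
      push_cast
      ring

end Homogenisation

/-! Sequences tending to boundary points -/

section Tends

variable {X : Type*} [MetricSpace X] [HyperbolicSpace X] {x y : ℕ → X} {ζ ξ : GromovBoundary X}

theorem gromovClose_of_mk_eq (a b : GromovSeq X)
    (h : Quotient.mk gromovSetoid a = Quotient.mk gromovSetoid b) : GromovClose a.1 b.1 :=
  Quotient.exact h

theorem exists_tendsToBoundary (ζ : GromovBoundary X) : ∃ x : ℕ → X, TendsToBoundary x ζ := by
  induction ζ using Quotient.inductionOn with
  | h x => exact ⟨x.1, x.2, rfl⟩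

theorem TendsToBoundary.self (hx : TendsToBoundary x ζ) : GromovClose x x := hx.1

theorem TendsToBoundary.close (hx : TendsToBoundary x ζ) (hy : TendsToBoundary y ζ) :
    GromovClose x y :=
  gromovClose_of_mk_eq ⟨x, hx.1⟩ ⟨y, hy.1⟩ (hx.2.symm.trans hy.2)

theorem TendsToBoundary.of_close (hx : TendsToBoundary x ζ) (h : GromovClose x y) :
    TendsToBoundary y ζ := by
  obtain ⟨hx, rfl⟩ := hx
  exact ⟨h.symm.trans h, Quotient.sound (s := gromovSetoid) h⟩

theorem TendsToBoundary.unique (hx : TendsToBoundary x ζ) (hx' : TendsToBoundary x ξ) :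
    ζ = ξ := by
  obtain ⟨_, rfl⟩ := hx
  obtain ⟨_, rfl⟩ := hx'
  rfl

theorem TendsToBoundary.not_close (hx : TendsToBoundary x ζ) (hy : TendsToBoundary y ξ)
    (hne : ζ ≠ ξ) : ¬ GromovClose x y := fun h => hne ((hx.of_close h).unique hy)

theorem TendsToBoundary.smul {G : Type*} [Group G] [MulAction G X] [IsIsometricSMul G X]
    (hx : TendsToBoundary x ζ) (g : G) : TendsToBoundary (fun n => g • x n) (g • ζ) := by
  obtain ⟨hx, rfl⟩ := hx
  exact ⟨hx.smul g, rfl⟩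

end Tends

/-! Horofunctions -/

section Horofunction

variable {X : Type*} [MetricSpace X] {x y : ℕ → X} {δ : ℝ}

/-- The four point inequality with constant `δ`. -/
def FourPoint (X : Type*) [MetricSpace X] (δ : ℝ) : Prop :=
  ∀ x y z w : X, min (gromovProduct x y w) (gromovProduct y z w) - δ ≤ gromovProduct x z w

theorem gromovProduct_le_dist (x y w : X) : gromovProduct x y w ≤ dist y w := by
  have := dist_triangle x y w
  simp only [gromovProduct]
  linarith

theorem gromovProduct_nonneg (x y w : X) : 0 ≤ gromovProduct x y w := by
  have := dist_triangle_right x y w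
  simp only [gromovProduct]
  linarith

/-- A product with `z` at `w` never exceeds `dist z w`. Once `(x | y)_w` is larger than that, the
minimum in the four point inequality is the term containing `z`. Used in both directions, this makes
`(x | z)_w` and `(y | z)_w` differ by at most `δ`; doubling gives the constant. -/
theorem GromovClose.eventually_abs_le (h : GromovClose x y)
    (hδ : FourPoint X δ) (z w : X) :
    ∀ᶠ p : ℕ × ℕ in atTop,
      |(dist (x p.1) w - dist (x p.1) z) - (dist (y p.2) w - dist (y p.2) z)| ≤ 2 * δ := by
  filter_upwards [tendsto_atTop.1 (h w) (dist z w)] with p hp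
  have h1 := hδ (x p.1) (y p.2) z w
  have h2 := hδ (y p.2) (x p.1) z w
  rw [min_eq_right ((gromovProduct_le_dist _ _ _).trans hp)] at h1
  rw [min_eq_right ((gromovProduct_le_dist _ _ _).trans
    (hp.trans (gromovProduct_comm _ _ _).le))] at h2
  simp only [gromovProduct] at h1 h2
  rw [abs_le]
  constructor <;> linarith

/-- The tail of `y` bounds the tail of `x` on both sides, so the real `liminf` is a genuine one and
inherits these bounds. From here on horofunctions are handled through distances to a single far
point. -/
theorem eventually_quasiHorofunction (h : GromovClose x y)
    (hδ : FourPoint X δ) (z : X) :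
    ∀ᶠ n in atTop, |quasiHorofunction x z - (dist (y n) (x 0) - dist (y n) z)| ≤ 2 * δ := by
  obtain ⟨a, ha⟩ := eventually_atTop.1 (h.eventually_abs_le hδ z (x 0))
  refine eventually_atTop.2 ⟨a.2, fun n hn => ?_⟩
  have key : ∀ m ≥ a.1, |(dist (x m) (x 0) - dist (x m) z)
      - (dist (y n) (x 0) - dist (y n) z)| ≤ 2 * δ := fun m hm => ha (m, n) ⟨hm, hn⟩
  have hub : ∀ᶠ m in atTop, dist (x m) (x 0) - dist (x m) z
      ≤ dist (y n) (x 0) - dist (y n) z + 2 * δ :=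
    eventually_atTop.2 ⟨a.1, fun m hm => by linarith [(abs_le.1 (key m hm)).2]⟩
  have hlb : ∀ᶠ m in atTop, dist (y n) (x 0) - dist (y n) z - 2 * δ
      ≤ dist (x m) (x 0) - dist (x m) z :=
    eventually_atTop.2 ⟨a.1, fun m hm => by linarith [(abs_le.1 (key m hm)).1]⟩
  have hu : IsBoundedUnder (· ≤ ·) atTop fun m => dist (x m) (x 0) - dist (x m) z := ⟨_, hub⟩
  have hl : IsBoundedUnder (· ≥ ·) atTop fun m => dist (x m) (x 0) - dist (x m) z := ⟨_, hlb⟩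
  have h1 : quasiHorofunction x z ≤ dist (y n) (x 0) - dist (y n) z + 2 * δ :=
    liminf_le_of_frequently_le hub.frequently hl
  have h2 : dist (y n) (x 0) - dist (y n) z - 2 * δ ≤ quasiHorofunction x z :=
    le_liminf_of_le hu.isCoboundedUnder_ge hlb
  rw [abs_le]
  constructor <;> linarith

theorem eventually_quasiHorofunction_sub (h : GromovClose x y)
    (hδ : FourPoint X δ) (z w : X) :
    ∀ᶠ n in atTop, |(quasiHorofunction x z - quasiHorofunction x w)
      - (dist (y n) w - dist (y n) z)| ≤ 4 * δ := by
  filter_upwards [eventually_quasiHorofunction h hδ z, eventually_quasiHorofunction h hδ w]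
    with n h1 h2
  rw [abs_le] at h1 h2 ⊢
  constructor <;> linarith

/-- Horofunctions at the same boundary point have nearly the same increments. -/
theorem abs_quasiHorofunction_sub_sub_le (h : GromovClose x y) (hy : GromovClose y y)
    (hδ : FourPoint X δ) (z w : X) :
    |(quasiHorofunction x z - quasiHorofunction x w)
      - (quasiHorofunction y z - quasiHorofunction y w)| ≤ 8 * δ := by
  obtain ⟨n, h1, h2⟩ := ((eventually_quasiHorofunction_sub h hδ z w).and
    (eventually_quasiHorofunction_sub hy hδ z w)).exists
  rw [abs_le] at h1 h2 ⊢
  constructor <;> linarith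

theorem abs_quasiHorofunction_sub_le (h : GromovClose x x) (hδ : FourPoint X δ) (z w : X) :
    |quasiHorofunction x z - quasiHorofunction x w| ≤ dist z w + 4 * δ := by
  obtain ⟨n, h1⟩ := (eventually_quasiHorofunction_sub h hδ z w).exists
  have h2 := dist_triangle (x n) z w
  have h3 := dist_triangle_right (x n) z w
  rw [abs_le] at h1 ⊢
  constructor <;> linarith [dist_triangle (x n) w z, dist_comm z w]

theorem quasiHorofunction_zero (x : ℕ → X) : quasiHorofunction x (x 0) = 0 := by
  simp [quasiHorofunction]

theorem quasiHorofunction_smul {G : Type*} [Group G] [MulAction G X] [IsIsometricSMul G X]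
    (x : ℕ → X) (g : G) (z : X) :
    quasiHorofunction (fun n => g • x n) (g • z) = quasiHorofunction x z := by
  simp [quasiHorofunction]

end Horofunction

/-! Busemann quasi-morphisms -/

section BusemannQuasimorphism

variable {X : Type*} [MetricSpace X] [HyperbolicSpace X] {H : Type*} [Group H] [MulAction H X]
  {ζ ξ : GromovBoundary X} {B B' : H → ℝ} {x : ℕ → X}

theorem exists_fourPoint (X : Type*) [MetricSpace X] [HyperbolicSpace X] : ∃ δ, FourPoint X δ :=
  HyperbolicSpace.hyperbolic

/-- A Busemann quasi-morphism can be computed with any sequence and any base point. -/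
theorem IsBusemannAt.exists_bound (hB : IsBusemannAt ζ B) (hx : TendsToBoundary x ζ)
    [IsIsometricSMul H X] (w : X) :
    ∃ C, ∀ g : H, |quasiHorofunction x (g • w) - quasiHorofunction x w - B g| ≤ C := by
  obtain ⟨δ, hδ⟩ := exists_fourPoint X
  obtain ⟨-, y, hy, C, hC⟩ := hB
  refine ⟨C + 2 * (dist w (y 0) + 4 * δ) + 8 * δ, fun g => ?_⟩
  have h1 := abs_le.1 (abs_quasiHorofunction_sub_sub_le (hx.close hy) hy.self hδ (g • w) w)
  have h2 := abs_le.1 (abs_quasiHorofunction_sub_le hy.self hδ (g • w) (g • y 0))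
  have h3 := abs_le.1 (abs_quasiHorofunction_sub_le hy.self hδ w (y 0))
  have h4 := abs_le.1 (hC g)
  rw [dist_smul] at h2
  rw [quasiHorofunction_zero] at h3
  rw [abs_le]
  constructor <;> linarith

theorem isBusemannAt_of_bound [IsIsometricSMul H X] (hB : IsHomogeneousQuasimorphism B)
    (hx : TendsToBoundary x ζ) {w : X} {C : ℝ}
    (hC : ∀ g : H, |quasiHorofunction x (g • w) - quasiHorofunction x w - B g| ≤ C) :
    IsBusemannAt ζ B := by
  obtain ⟨δ, hδ⟩ := exists_fourPoint X
  refine ⟨hB, x, hx, C + 2 * (dist w (x 0) + 4 * δ), fun g => ?_⟩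
  have h2 := abs_le.1 (abs_quasiHorofunction_sub_le hx.self hδ (g • w) (g • x 0))
  have h3 := abs_le.1 (abs_quasiHorofunction_sub_le hx.self hδ w (x 0))
  have h4 := abs_le.1 (hC g)
  rw [dist_smul] at h2
  rw [quasiHorofunction_zero] at h3
  rw [abs_le]
  constructor <;> linarith

theorem IsBusemannAt.unique [IsIsometricSMul H X] (hB : IsBusemannAt ζ B)
    (hB' : IsBusemannAt ζ B') : B = B' := by
  obtain ⟨x, hx⟩ := exists_tendsToBoundary ζ
  obtain ⟨C, hC⟩ := hB.exists_bound hx (x 0)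
  obtain ⟨C', hC'⟩ := hB'.exists_bound hx (x 0)
  refine hB.1.eq_of_bounded hB'.1 (C := C + C') fun g => ?_
  have h1 := abs_le.1 (hC g)
  have h2 := abs_le.1 (hC' g)
  rw [abs_le]
  constructor <;> linarith

/-- As `g` fixes `ζ`, the translated sequence `g • x` still tends to `ζ`, so its horofunction has
nearly the increments of that of `x`. The increment from `g • x 0` to `g • h • x 0` is then nearly
the value at `h • x 0`, which is the quasi-morphism property. -/
theorem exists_isBusemannAt [IsIsometricSMul H X] (hζ : ∀ g : H, g • ζ = ζ) :
    ∃ B : H → ℝ, IsBusemannAt ζ B := by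
  obtain ⟨δ, hδ⟩ := exists_fourPoint X
  obtain ⟨x, hx⟩ := exists_tendsToBoundary ζ
  obtain ⟨B, hB, C, hC⟩ := exists_homogenisation (H := H)
    (f := fun g => quasiHorofunction x (g • x 0)) (D := 8 * δ) fun g h => by
      have hgx : TendsToBoundary (fun n => g • x n) ζ := by
        simpa only [hζ g] using hx.smul g
      have h1 := abs_quasiHorofunction_sub_sub_le (hx.close hgx) hgx.self hδ
        (g • h • x 0) (g • x 0)
      rw [quasiHorofunction_smul, quasiHorofunction_smul, quasiHorofunction_zero, sub_zero] at h1
      rw [mul_smul]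
      exact h1
  exact ⟨B, hB, x, hx, C, hC⟩

theorem IsBusemannAt.comp_subgroup {K : Subgroup H} (hB : IsBusemannAt ζ B) :
    IsBusemannAt ζ (fun k : K => B k) := by
  obtain ⟨h, x, hx, C, hC⟩ := hB
  exact ⟨h.comp K.subtype, x, hx, C, fun g => hC g⟩

end BusemannQuasimorphism

/-! Pairs of boundary points fixed by a subgroup -/

theorem gromovProduct_le_add_dist {X : Type*} [MetricSpace X] (x y w w' : X) :
    gromovProduct x y w ≤ gromovProduct x y w' + dist w w' := by
  have h1 := dist_triangle x w' w
  have h2 := dist_triangle y w' w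
  rw [dist_comm w' w] at h1 h2
  simp only [gromovProduct]
  linarith

theorem gromovProduct_smul {X G : Type*} [MetricSpace X] [Group G] [MulAction G X]
    [IsIsometricSMul G X] (g : G) (x y w : X) :
    gromovProduct (g • x) (g • y) (g • w) = gromovProduct x y w := by
  simp [gromovProduct]

instance isIsometricSMul_subgroup {X G : Type*} [MetricSpace X] [Group G] [MulAction G X]
    [IsIsometricSMul G X] (K : Subgroup G) : IsIsometricSMul K X :=
  ⟨fun k => isometry_smul X (k : G)⟩

section FixedPair

variable {X : Type*} [MetricSpace X] [HyperbolicSpace X] {ζ ξ : GromovBoundary X}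

/-- Gromov products of sequences tending to distinct boundary points are eventually bounded,
uniformly in the sequences. -/
theorem exists_eventually_gromovProduct_le (hne : ζ ≠ ξ) (w : X) :
    ∃ R : ℝ, ∀ x y : ℕ → X, TendsToBoundary x ζ → TendsToBoundary y ξ →
      ∀ᶠ n in atTop, gromovProduct (x n) (y n) w ≤ R := by
  obtain ⟨δ, hδ⟩ := exists_fourPoint X
  obtain ⟨a, ha⟩ := exists_tendsToBoundary ζ
  obtain ⟨b, hb⟩ := exists_tendsToBoundary ξ
  have hnc := ha.not_close hb hne
  simp only [GromovClose, not_forall] at hnc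
  obtain ⟨w', hw'⟩ := hnc
  rw [tendsto_atTop] at hw'
  push Not at hw'
  obtain ⟨r, hr⟩ := hw'
  refine ⟨r + dist w w' + 2 * δ, fun x y hx hy => ?_⟩
  -- Two four point inequalities along `a i, x n, y n, b j` give `(a | b) ≥ min ((a | x), (x | y),
  -- (y | b)) - 2 * δ`. The outer products exceed the threshold, so a small `(a | b)` forces a small
  -- `(x | y)`. The term `|δ|` allows for an unknown sign of `δ`.
  obtain ⟨p, hp⟩ := eventually_atTop.1
    (tendsto_atTop.1 (ha.close hx w) (r + dist w w' + 2 * δ + |δ| + 1))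
  obtain ⟨q, hq⟩ := eventually_atTop.1
    (tendsto_atTop.1 (hy.close hb w) (r + dist w w' + 2 * δ + |δ| + 1))
  obtain ⟨⟨i, j⟩, hr', hi, hj⟩ :=
    (hr.and_eventually (eventually_ge_atTop (p.1, q.2))).exists
  refine eventually_atTop.2 ⟨max p.2 q.1, fun n hn => ?_⟩
  have h1 := hp (i, n) ⟨hi, (le_max_left _ _).trans hn⟩
  have h2 := hq (n, j) ⟨(le_max_right _ _).trans hn, hj⟩
  have h3 := gromovProduct_le_add_dist (a i) (b j) w w'
  have h4 := hδ (a i) (x n) (b j) w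
  have h5 := hδ (x n) (y n) (b j) w
  simp only at h1 h2 hr'
  have h6 := le_abs_self δ
  have h7 := neg_abs_le δ
  rcases min_cases (gromovProduct (a i) (x n) w) (gromovProduct (x n) (b j) w) with h8 | h8 <;>
  rcases min_cases (gromovProduct (x n) (y n) w) (gromovProduct (y n) (b j) w) with h9 | h9 <;>
  linarith

variable {G : Type*} [Group G] [MulAction G X] [IsIsometricSMul G X] {K : Subgroup G}

theorem exists_isBusemannAt_subgroup (hζ : ∀ g ∈ K, g • ζ = ζ) :
    ∃ B : K → ℝ, IsBusemannAt ζ B := by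
  refine exists_isBusemannAt fun g => Eq.trans ?_ (hζ g g.2)
  -- The boundary action induced by `K` and the one induced by `G` are different instances, which
  -- agree on representatives.
  induction ζ using Quotient.inductionOn with
  | h x => rfl

/-- The main estimates for a subgroup fixing two boundary points: on an orbit, the two
horofunctions are nearly opposite, and the metric is nearly the difference of their values. -/
theorem exists_busemann_bounds (hne : ζ ≠ ξ) (hζ : ∀ g ∈ K, g • ζ = ζ) (hξ : ∀ g ∈ K, g • ξ = ξ)
    {B B' : K → ℝ} (hB : IsBusemannAt ζ B) (hB' : IsBusemannAt ξ B') (w : X) :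
    ∃ C, ∀ g : K, |B g + B' g| ≤ C ∧ |B g| ≤ dist w ((g : G) • w) + C ∧
      (dist w ((g : G) • w) + B g ≤ C ∨ dist w ((g : G) • w) + B' g ≤ C) := by
  obtain ⟨δ, hδ⟩ := exists_fourPoint X
  obtain ⟨x, hx⟩ := exists_tendsToBoundary ζ
  obtain ⟨y, hy⟩ := exists_tendsToBoundary ξ
  obtain ⟨R, hR⟩ := exists_eventually_gromovProduct_le hne w
  obtain ⟨c, hc⟩ := hB.exists_bound hx w
  obtain ⟨c', hc'⟩ := hB'.exists_bound hy w
  refine ⟨2 * |R| + 2 * |δ| + 8 * |δ| + |c| + |c'|, fun g => ?_⟩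
  -- The bound `R` also holds for these translates, so it bounds the product of `x n` and `y n`
  -- based at `g • w`. The difference of the products at `w` and at `g • w` is half the sum of the
  -- two horofunction increments, whence `|B g + B' g| ≤ C`.
  have hx' : TendsToBoundary (fun n => (g : G)⁻¹ • x n) ζ := by
    simpa only [hζ _ (K.inv_mem g.2)] using hx.smul (g : G)⁻¹
  have hy' : TendsToBoundary (fun n => (g : G)⁻¹ • y n) ξ := by
    simpa only [hξ _ (K.inv_mem g.2)] using hy.smul (g : G)⁻¹
  obtain ⟨n, ⟨h1, h2⟩, h3, h4⟩ := (((hR x y hx hy).and (hR _ _ hx' hy')).and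
    ((eventually_quasiHorofunction_sub hx.self hδ ((g : G) • w) w).and
    (eventually_quasiHorofunction_sub hy.self hδ ((g : G) • w) w))).exists
  have h5 := gromovProduct_smul (g : G) ((g : G)⁻¹ • x n) ((g : G)⁻¹ • y n) w
  rw [smul_inv_smul, smul_inv_smul] at h5
  rw [← h5] at h2
  have h6 := gromovProduct_nonneg (x n) (y n) w
  have h7 := gromovProduct_nonneg (x n) (y n) ((g : G) • w)
  -- Since `(x n | y n)_w` is bounded, one of `(x n | g • w)_w` and `(g • w | y n)_w` is bounded;
  -- twice that product is `dist w (g • w)` plus a horofunction increment.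
  have h8 := hδ (x n) ((g : G) • w) (y n) w
  have h9 := abs_le.1 (hc g)
  have h10 := abs_le.1 (hc' g)
  have h11 := abs_le.1 (abs_quasiHorofunction_sub_le hx.self hδ ((g : G) • w) w)
  change _ ≤ quasiHorofunction x ((g : G) • w) - _ - _ ∧ _ at h9
  change _ ≤ quasiHorofunction y ((g : G) • w) - _ - _ ∧ _ at h10
  rw [Subgroup.smul_def] at h9 h10
  rw [abs_le] at h3 h4
  have d0 := le_abs_self δ
  have r0 := le_abs_self R
  have c0 := le_abs_self c
  have c0' := le_abs_self c'
  have d1 := abs_nonneg δ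
  have r1 := abs_nonneg R
  have c1 := abs_nonneg c
  have c1' := abs_nonneg c'
  rw [dist_comm ((g : G) • w) w] at h11
  refine ⟨?_, ?_, ?_⟩
  · simp only [gromovProduct] at h1 h2 h6 h7
    rw [abs_le]
    constructor <;> linarith
  · rw [abs_le]
    constructor <;> linarith
  · simp only [gromovProduct] at h1 h2 h6 h7 h8
    rw [dist_comm ((g : G) • w) w, dist_comm ((g : G) • w) (y n)] at h8
    rcases min_cases ((dist (x n) w + dist w ((g : G) • w) - dist (x n) ((g : G) • w)) / 2)
      ((dist w ((g : G) • w) + dist (y n) w - dist (y n) ((g : G) • w)) / 2) with h | h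
    · left; linarith
    · right; linarith

theorem busemann_eq_neg (hne : ζ ≠ ξ) (hζ : ∀ g ∈ K, g • ζ = ζ) (hξ : ∀ g ∈ K, g • ξ = ξ)
    {B B' : K → ℝ} (hB : IsBusemannAt ζ B) (hB' : IsBusemannAt ξ B') (g : K) :
    B' g = -B g := by
  obtain ⟨x, -⟩ := exists_tendsToBoundary ζ
  obtain ⟨C, hC⟩ := exists_busemann_bounds hne hζ hξ hB hB' (x 0)
  refine congrFun (hB'.1.eq_of_bounded hB.1.neg (C := C) fun g => ?_) g
  rw [sub_neg_eq_add, add_comm]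
  exact (hC g).1

/-- On a subgroup fixing two boundary points, displacement is the absolute value of the Busemann
quasi-morphism, up to a bounded error. -/
theorem exists_abs_dist_sub_abs_busemann_le (hne : ζ ≠ ξ) (hζ : ∀ g ∈ K, g • ζ = ζ)
    (hξ : ∀ g ∈ K, g • ξ = ξ) {B : K → ℝ} (hB : IsBusemannAt ζ B) (w : X) :
    ∃ C, ∀ g : K, |dist w ((g : G) • w) - (|B g|)| ≤ C := by
  obtain ⟨B', hB'⟩ := exists_isBusemannAt_subgroup hξ
  obtain ⟨C, hC⟩ := exists_busemann_bounds hne hζ hξ hB hB' w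
  refine ⟨C, fun g => ?_⟩
  obtain ⟨-, h1, h2⟩ := hC g
  rw [busemann_eq_neg hne hζ hξ hB hB' g] at h2
  have h3 := le_abs_self (B g)
  have h4 := neg_abs_le (B g)
  rw [abs_le]
  constructor
  · linarith
  · rcases h2 with h2 | h2 <;> linarith

/-- Transport of Busemann quasi-morphisms by an element of the ambient group. -/
theorem busemann_conj {B B' : K → ℝ} (hB : IsBusemannAt ζ B) (t : G)
    (hB' : IsBusemannAt (t • ζ) B') {h h' : K} (e : (h' : G) = t * h * t⁻¹) : B' h' = B h := by
  obtain ⟨x, hx⟩ := exists_tendsToBoundary ζ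
  obtain ⟨C, hC⟩ := hB.exists_bound hx (x 0)
  obtain ⟨C', hC'⟩ := hB'.exists_bound (hx.smul t) (t • x 0)
  refine sub_eq_zero.1 (eq_zero_of_forall_nat_mul_abs_le (C := C + C') fun n => ?_)
  have h1 := abs_le.1 (hC (h ^ n))
  have h2 := abs_le.1 (hC' (h' ^ n))
  have h3 : (h' ^ n) • t • x 0 = t • (h ^ n) • x 0 := by
    simp only [Subgroup.smul_def, Subgroup.coe_pow, e, conj_pow, smul_smul, inv_mul_cancel_right]
  rw [h3, quasiHorofunction_smul, quasiHorofunction_smul, hB'.1.map_npow] at h2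
  rw [hB.1.map_npow] at h1
  rw [← Nat.abs_cast n, ← abs_mul, mul_sub, abs_le]
  constructor <;> linarith

end FixedPair

/-! Lineal actions -/

section LinealActions

variable {G X : Type*} [Group G] [MetricSpace X] [HyperbolicSpace X] [MulAction G X]
  {ζ ξ : GromovBoundary X}

theorem IsLineal.exists_ne (hL : IsLineal G X) :
    ∃ ζ ∈ limitSet G X, ∃ ξ ∈ limitSet G X, ζ ≠ ξ := by
  obtain ⟨ζ, ξ, hne, h⟩ := Set.encard_eq_two.1 hL
  exact ⟨ζ, by simp [h], ξ, by simp [h], hne⟩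

theorem IsLineal.exists_mem_ne (hL : IsLineal G X) (ζ : GromovBoundary X) :
    ∃ ξ ∈ limitSet G X, ζ ≠ ξ := by
  obtain ⟨a, ha, b, hb, hne⟩ := hL.exists_ne
  by_cases h : ζ = a
  · exact ⟨b, hb, h ▸ hne⟩
  · exact ⟨a, ha, h⟩

theorem IsLineal.eq_or_eq (hL : IsLineal G X) (hζ : ζ ∈ limitSet G X) (hξ : ξ ∈ limitSet G X)
    (hne : ζ ≠ ξ) {η : GromovBoundary X} (hη : η ∈ limitSet G X) : η = ζ ∨ η = ξ := by
  obtain ⟨a, b, -, h⟩ := Set.encard_eq_two.1 hL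
  rw [h] at hζ hξ hη
  simp only [Set.mem_insert_iff, Set.mem_singleton_iff] at hζ hξ hη
  grind

theorem IsLineal.nonempty (hL : IsLineal G X) : Nonempty X := by
  obtain ⟨ζ, ⟨x, -⟩, -⟩ := hL.exists_ne
  exact ⟨x⟩

variable [IsIsometricSMul G X]

theorem smul_mem_limitSet (hζ : ζ ∈ limitSet G X) (g : G) : g • ζ ∈ limitSet G X := by
  obtain ⟨x, u, hu⟩ := hζ
  refine ⟨x, fun n => g * u n, ?_⟩
  simpa only [mul_smul] using hu.smul g

theorem smul_eq_of_mem_orientationSubgroup (hζ : ζ ∈ limitSet G X) :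
    ∀ g ∈ orientationSubgroup G X, g • ζ = ζ := fun _ hg =>
  (mem_fixingSubgroup_iff G).1 hg ζ hζ

theorem orientationSubgroup_eq_top_iff :
    orientationSubgroup G X = ⊤ ↔ ∀ ζ ∈ limitSet G X, ∀ g : G, g • ζ = ζ := by
  simp only [Subgroup.eq_top_iff', orientationSubgroup, mem_fixingSubgroup_iff]
  exact ⟨fun h ζ hζ g => h g ζ hζ, fun h g ζ hζ => h ζ hζ g⟩

theorem IsLineal.smul_eq_of_notMem (hL : IsLineal G X) (hζ : ζ ∈ limitSet G X)
    (hξ : ξ ∈ limitSet G X) (hne : ζ ≠ ξ) {t : G} (ht : t ∉ orientationSubgroup G X) :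
    t • ζ = ξ := by
  rcases hL.eq_or_eq hζ hξ hne (smul_mem_limitSet hζ t) with h1 | h1
  · refine absurd ((mem_fixingSubgroup_iff G).2 fun η hη => ?_) ht
    rcases hL.eq_or_eq hζ hξ hne hη with rfl | rfl
    · exact h1
    · rcases hL.eq_or_eq hζ hξ hne (smul_mem_limitSet hξ t) with h2 | h2
      · exact absurd (MulAction.injective t (h1.trans h2.symm)) hne
      · exact h2
  · exact h1

theorem IsLineal.mul_mem_of_notMem (hL : IsLineal G X) {s t : G}
    (hs : s ∉ orientationSubgroup G X) (ht : t ∉ orientationSubgroup G X) :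
    s * t ∈ orientationSubgroup G X := by
  refine (mem_fixingSubgroup_iff G).2 fun η hη => ?_
  obtain ⟨ξ, hξ, hne⟩ := hL.exists_mem_ne η
  rw [mul_smul, hL.smul_eq_of_notMem hη hξ hne ht, hL.smul_eq_of_notMem hξ hη hne.symm hs]

theorem IsLineal.index_eq_two (hL : IsLineal G X) (h : orientationSubgroup G X ≠ ⊤) :
    (orientationSubgroup G X).index = 2 := by
  obtain ⟨t, ht⟩ : ∃ t, t ∉ orientationSubgroup G X := by
    by_contra! h'
    exact h ((Subgroup.eq_top_iff' _).2 h')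
  refine Subgroup.index_eq_two_iff.2 ⟨t, fun b => ?_⟩
  by_cases hb : b ∈ orientationSubgroup G X
  · exact Or.inr ⟨hb, fun h' => ht (((orientationSubgroup G X).mul_mem_cancel_left hb).1 h')⟩
  · exact Or.inl ⟨hL.mul_mem_of_notMem hb ht, hb⟩

theorem IsLineal.sq_mem (hL : IsLineal G X) (g : G) : g ^ 2 ∈ orientationSubgroup G X := by
  rw [sq]
  by_cases hg : g ∈ orientationSubgroup G X
  · exact mul_mem hg hg
  · exact hL.mul_mem_of_notMem hg hg

theorem conj_mem_orientationSubgroup {h : G} (hh : h ∈ orientationSubgroup G X) (g : G) :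
    g * h * g⁻¹ ∈ orientationSubgroup G X := by
  refine (mem_fixingSubgroup_iff G).2 fun η hη => ?_
  rw [mul_smul, mul_smul, smul_eq_of_mem_orientationSubgroup (smul_mem_limitSet hη g⁻¹) h hh,
    smul_inv_smul]

/-- A single correction by a bounded amount moves every element into the orientation preserving
subgroup. -/
theorem IsLineal.exists_correction (hL : IsLineal G X) :
    ∃ t : G, ∀ g : G, g ∈ orientationSubgroup G X ∨ g * t ∈ orientationSubgroup G X := by
  by_cases h : ∃ t, t ∉ orientationSubgroup G X
  · obtain ⟨t, ht⟩ := h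
    exact ⟨t, fun g => or_iff_not_imp_left.2 fun hg => hL.mul_mem_of_notMem hg ht⟩
  · push Not at h
    exact ⟨1, fun g => Or.inl (h g)⟩

theorem IsLineal.exists_abs_dist_sub_le (hL : IsLineal G X) (hζ : ζ ∈ limitSet G X)
    {B : orientationSubgroup G X → ℝ} (hB : IsBusemannAt ζ B) (w : X) :
    ∃ C, ∀ g : orientationSubgroup G X, |dist w ((g : G) • w) - (|B g|)| ≤ C := by
  obtain ⟨ξ, hξ, hne⟩ := hL.exists_mem_ne ζ
  exact exists_abs_dist_sub_abs_busemann_le hne (smul_eq_of_mem_orientationSubgroup hζ)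
    (smul_eq_of_mem_orientationSubgroup hξ) hB w

/-- The Gromov product of two orbit points is at most the displacement of either, so an orbit
sequence tending to the boundary is unbounded. Moving its elements into the orientation subgroup
costs at most `dist w (t • w)`. -/
theorem IsLineal.exists_lt_dist (hL : IsLineal G X) :
    ∃ w : X, ∀ R : ℝ, ∃ g ∈ orientationSubgroup G X, R < dist w (g • w) := by
  obtain ⟨ζ, ⟨w, u, hu⟩, -⟩ := hL.exists_ne
  obtain ⟨t, ht⟩ := hL.exists_correction
  refine ⟨w, fun R => ?_⟩
  obtain ⟨p, hp⟩ := (tendsto_atTop.1 (hu.self w) (R + dist w (t • w) + 1)).exists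
  have h1 := hp.trans (gromovProduct_le_dist _ _ _)
  rw [dist_comm (u p.2 • w)] at h1
  rcases ht (u p.2) with h | h
  · exact ⟨_, h, by linarith [dist_nonneg (x := w) (y := t • w)]⟩
  · refine ⟨_, h, ?_⟩
    have h2 := dist_triangle_right w (u p.2 • w) (u p.2 • t • w)
    rw [dist_smul] at h2
    rw [mul_smul]
    linarith

theorem IsLineal.exists_busemann_ne_zero (hL : IsLineal G X) (hζ : ζ ∈ limitSet G X)
    {B : orientationSubgroup G X → ℝ} (hB : IsBusemannAt ζ B) : ∃ g, B g ≠ 0 := by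
  obtain ⟨w, hw⟩ := hL.exists_lt_dist
  obtain ⟨C, hC⟩ := hL.exists_abs_dist_sub_le hζ hB w
  obtain ⟨g, hg, h⟩ := hw C
  refine ⟨⟨g, hg⟩, fun h0 => ?_⟩
  have := (abs_le.1 (hC ⟨g, hg⟩)).2
  rw [h0, abs_zero, sub_zero] at this
  linarith

/-- Conjugation by an element that swaps the ends carries the quasi-morphism at one end to that at
the other, and the two are opposite. -/
theorem IsLineal.busemann_conj_eq_neg (hL : IsLineal G X) (hζ : ζ ∈ limitSet G X)
    {B : orientationSubgroup G X → ℝ} (hB : IsBusemannAt ζ B) {t : G}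
    (ht : t ∉ orientationSubgroup G X) {h h' : orientationSubgroup G X}
    (e : (h' : G) = t * h * t⁻¹) : B h' = -B h := by
  obtain ⟨ξ, hξ, hne⟩ := hL.exists_mem_ne ζ
  obtain ⟨B', hB'⟩ := exists_isBusemannAt_subgroup (smul_eq_of_mem_orientationSubgroup hξ)
  have h1 := hL.smul_eq_of_notMem hζ hξ hne ht
  have h2 := busemann_conj hB t (h1 ▸ hB') e
  have h3 := busemann_eq_neg hne (smul_eq_of_mem_orientationSubgroup hζ)
    (smul_eq_of_mem_orientationSubgroup hξ) hB hB' h'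
  linarith

end LinealActions

/-! Comparison of orbits -/

section Orbits

variable {G X Y Z : Type*} [Group G] [MetricSpace X] [MetricSpace Y] [MetricSpace Z]
  [MulAction G Y] [MulAction G Z]

/-- Displacements of `y` are coarsely dominated by displacements of `z`. -/
def OrbitDominated (G : Type*) {Y Z : Type*} [Group G] [MetricSpace Y] [MetricSpace Z]
    [MulAction G Y] [MulAction G Z] (y : Y) (z : Z) : Prop :=
  ∃ M C : ℝ, 0 ≤ M ∧ 0 ≤ C ∧ ∀ g : G, dist y (g • y) ≤ M * dist z (g • z) + C

/-- Two actions to which the same quasi-action reduces have comparable orbits. -/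
theorem orbitDominated_of_reducesTo {α : G → X → X} (hα : IsQuasiAction α)
    (hY : ReducesTo α fun (g : G) (y : Y) => g • y)
    (hZ : ReducesTo α fun (g : G) (z : Z) => g • z) (y : Y) (z : Z) :
    OrbitDominated G y z := by
  obtain ⟨K₀, ε₀, _, hα, -⟩ := hα
  obtain ⟨F, ⟨K, ε, hK, hε, hF⟩, M, hM, hFe⟩ := hY
  obtain ⟨F', ⟨K', ε', hK', hε', hF'⟩, M', hM', hFe'⟩ := hZ
  obtain ⟨hK₀, hε₀, -⟩ := (hα 1).1
  have hd := dist_nonneg (x := F y) (y := F' z)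
  refine ⟨K * K', K * (ε' + M + M' + (1 + K₀) * dist (F y) (F' z) + ε₀ + ε), by positivity,
    by positivity, fun g => ?_⟩
  have h1 := (hF y (g • y)).1
  have h2 := (hF' z (g • z)).2
  have h3 : dist (F (g • y)) (α g (F y)) ≤ M := hFe y g
  have h4 : dist (F' (g • z)) (α g (F' z)) ≤ M' := hFe' z g
  have h5 := ((hα g).1.2.2 (F y) (F' z)).2
  -- The path is `F y`, `F' z`, `F' (g • z)`, `α g (F' z)`, `α g (F y)`, `F (g • y)`. The distance
  -- from `F y` to `F' z` is paid once directly and once after applying `α g`, hence the factor `1 +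
  -- K₀`.
  have h6 := dist_triangle4 (F y) (F' z) (F' (g • z)) (α g (F' z))
  have h7 := dist_triangle4 (F y) (α g (F' z)) (α g (F y)) (F (g • y))
  rw [dist_comm (α g (F' z)), dist_comm (α g (F y)) (F (g • y))] at h7
  have h8 : 1 / K * dist y (g • y) ≤ K' * dist z (g • z)
      + (ε' + M + M' + (1 + K₀) * dist (F y) (F' z) + ε₀ + ε) := by linarith
  have hK0 : 0 < K := by linarith
  rw [one_div, inv_mul_le_iff₀ hK0] at h8
  linarith

variable [IsIsometricSMul G Y] [IsIsometricSMul G Z]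

theorem isQuasiAction_smul : IsQuasiAction fun (g : G) (y : Y) => g • y := by
  refine ⟨1, 0, 0, fun g => ⟨⟨le_rfl, le_rfl, fun x y => ?_⟩, le_rfl, fun y => ?_⟩, fun x => ?_,
    fun x g h => ?_⟩
  · simp
  · exact ⟨g⁻¹ • y, by simp⟩
  · simp
  · simp [mul_smul]

theorem dist_smul_smul (g h : G) (y : Y) : dist (g • y) (h • y) = dist y ((g⁻¹ * h) • y) := by
  rw [mul_smul, ← dist_smul g y, smul_inv_smul]

theorem OrbitDominated.dist_le {y : Y} {z : Z} {M C : ℝ}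
    (h : ∀ g : G, dist y (g • y) ≤ M * dist z (g • z) + C) (g k : G) :
    dist (g • y) (k • y) ≤ M * dist (g • z) (k • z) + C := by
  rw [dist_smul_smul, dist_smul_smul]
  exact h _

/-- Cobounded isometric actions with comparable orbits are equivalent. -/
theorem areEquivalent_of_orbitDominated {y : Y} {z : Z}
    (hY : ∃ C, ∀ x : Y, ∃ g : G, dist (g • y) x ≤ C)
    (hZ : ∃ C, ∀ x : Z, ∃ g : G, dist (g • z) x ≤ C)
    (h : OrbitDominated G y z) (h' : OrbitDominated G z y) :
    AreEquivalent (fun (g : G) (y : Y) => g • y) (fun (g : G) (z : Z) => g • z) := by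
  obtain ⟨M, C, hM, hC, h⟩ := h
  obtain ⟨M', C', hM', hC', h'⟩ := h'
  obtain ⟨R, hR⟩ := hY
  obtain ⟨R', hR'⟩ := hZ
  choose φ hφ using hR
  have hR0 : 0 ≤ R := dist_nonneg.trans (hφ y)
  have hR0' : 0 ≤ R' := by
    obtain ⟨g, hg⟩ := hR' z
    exact dist_nonneg.trans hg
  have up : ∀ a b : Y, dist (φ a • z) (φ b • z) ≤ M' * (dist a b + 2 * R) + C' := fun a b => by
    refine (OrbitDominated.dist_le h' _ _).trans ?_
    have h1 := dist_triangle4 (φ a • y) a b (φ b • y)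
    rw [dist_comm b] at h1
    have h2 : dist (φ a • y) (φ b • y) ≤ dist a b + 2 * R := by linarith [hφ a, hφ b]
    gcongr
  have low : ∀ a b : Y, dist a b ≤ M * dist (φ a • z) (φ b • z) + C + 2 * R := fun a b => by
    have h1 := dist_triangle4 a (φ a • y) (φ b • y) b
    rw [dist_comm a (φ a • y)] at h1
    linarith [hφ a, hφ b, OrbitDominated.dist_le h (φ a) (φ b)]
  -- Each `x` is approximated by an orbit point `φ x • y`, whose counterpart in the orbit of `z` is
  -- its image. The constant `M + M' + 1` is at least 1 and serves both inequalities.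
  refine ⟨fun x => φ x • z, ⟨M + M' + 1, 2 * M' * R + C' + C + 2 * R, R' + M' * R + C', ?_⟩, ?_⟩
  · refine ⟨⟨by linarith, by positivity, fun a b => ⟨?_, ?_⟩⟩, by positivity, fun b => ?_⟩
    · have h1 := low a b
      have hpos : 0 < M + M' + 1 := by positivity
      have h2 : (M + M' + 1) * (1 / (M + M' + 1) * dist a b) = dist a b := by
        field_simp
      have h3 : 1 / (M + M' + 1) * dist a b
          ≤ dist (φ a • z) (φ b • z) + (C + 2 * R) := by
        rw [one_div, inv_mul_le_iff₀ hpos]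
        nlinarith [dist_nonneg (x := φ a • z) (y := φ b • z), mul_nonneg hM hC,
          mul_nonneg hM hR0, mul_nonneg hM' hC, mul_nonneg hM' hR0,
          mul_nonneg hM' (dist_nonneg (x := φ a • z) (y := φ b • z))]
      have h4 : 0 ≤ 2 * M' * R := by positivity
      linarith
    · have h1 := up a b
      have h2 : 0 ≤ (M + 1) * dist a b := by positivity
      linarith
    · obtain ⟨g, hg⟩ := hR' b
      refine ⟨g • y, ?_⟩
      have h1 := OrbitDominated.dist_le h' (φ (g • y)) g
      have h2 := dist_triangle (φ (g • y) • z) (g • z) b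
      have h3 := mul_le_mul_of_nonneg_left (hφ (g • y)) hM'
      linarith
  · refine ⟨M' * (2 * R) + C', by positivity, fun x g => ?_⟩
    simp only
    rw [← mul_smul]
    refine (OrbitDominated.dist_le h' _ _).trans ?_
    have h1 := dist_triangle_right (φ (g • x) • y) ((g * φ x) • y) (g • x)
    have h2 := hφ x
    rw [← dist_smul g, ← mul_smul] at h2
    have h3 : dist (φ (g • x) • y) ((g * φ x) • y) ≤ 2 * R := by linarith [hφ (g • x)]
    gcongr

end Orbits

/-! ### Comparison of lineal actions -/

section Comparison

variable {G Y Z : Type*} [Group G] [MetricSpace Y] [MetricSpace Z] [HyperbolicSpace Y]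
  [HyperbolicSpace Z] [MulAction G Y] [MulAction G Z] [IsIsometricSMul G Y] [IsIsometricSMul G Z]

/-- If `t` fixed the ends of `Y` but swapped those of `Z`, the elements `t * k ^ n * t⁻¹ * (k ^
n)⁻¹` would have bounded Busemann value in `Y`, whereas in `Z` the value is `-2 * n * B' k` up to a
constant. This contradicts orbit domination. -/
theorem orientationSubgroup_le (hY : IsLineal G Y) (hZ : IsLineal G Z)
    (h : ∀ (y : Y) (z : Z), OrbitDominated G z y) :
    orientationSubgroup G Y ≤ orientationSubgroup G Z := by
  intro t ht
  by_contra htZ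
  obtain ⟨ζ, hζ, -⟩ := hY.exists_ne
  obtain ⟨ξ, hξ, -⟩ := hZ.exists_ne
  obtain ⟨B, hB⟩ := exists_isBusemannAt_subgroup (smul_eq_of_mem_orientationSubgroup hζ)
  obtain ⟨B', hB'⟩ := exists_isBusemannAt_subgroup (smul_eq_of_mem_orientationSubgroup hξ)
  obtain ⟨y⟩ := hY.nonempty
  obtain ⟨z⟩ := hZ.nonempty
  obtain ⟨M, C, hM, -, hle⟩ := h y z
  obtain ⟨c, hc⟩ := hY.exists_abs_dist_sub_le hζ hB y
  obtain ⟨c', hc'⟩ := hZ.exists_abs_dist_sub_le hξ hB' z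
  obtain ⟨k₀, hk₀⟩ := hZ.exists_busemann_ne_zero hξ hB'
  obtain ⟨⟨D, hD⟩, -⟩ := id hB.1
  obtain ⟨⟨E, hE⟩, -⟩ := id hB'.1
  -- Squares lie in every orientation subgroup, so `k` is orientation preserving for both actions,
  -- while `B' k = 2 * B' k₀` stays nonzero.
  set k := k₀ ^ 2 with hk
  have hk0 : B' k ≠ 0 := by
    rw [hk, hB'.1.map_npow]
    simpa using hk₀
  have hkY : (k : G) ∈ orientationSubgroup G Y := by
    rw [hk, Subgroup.coe_pow]
    exact hY.sq_mem _
  let kY : orientationSubgroup G Y := ⟨k, hkY⟩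
  let tY : orientationSubgroup G Y := ⟨t, ht⟩
  let m : orientationSubgroup G Z := ⟨t * k * t⁻¹, conj_mem_orientationSubgroup k.2 t⟩
  have hm : B' m = -B' k := hZ.busemann_conj_eq_neg hξ hB' htZ rfl
  refine hk0 (eq_zero_of_forall_nat_mul_abs_le (C := M * (3 * D + c) + C + c' + E) fun n => ?_)
  have e : ((tY * kY ^ n * tY⁻¹ * (kY ^ n)⁻¹ : orientationSubgroup G Y) : G)
      = ((m ^ n * (k ^ n)⁻¹ : orientationSubgroup G Z) : G) := by
    simp [tY, kY, m, conj_pow]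
  have h1 : |B (tY * kY ^ n * tY⁻¹ * (kY ^ n)⁻¹)| ≤ 3 * D := by
    have h1 := abs_le.1 (hD (tY * kY ^ n * tY⁻¹) (kY ^ n)⁻¹)
    have h2 := abs_le.1 (hD (tY * kY ^ n) tY⁻¹)
    have h3 := abs_le.1 (hD tY (kY ^ n))
    rw [hB.1.map_inv] at h1 h2
    rw [abs_le]
    constructor <;> linarith
  have h2 := abs_le.1 (hE (m ^ n) (k ^ n)⁻¹)
  rw [hB'.1.map_inv, hB'.1.map_npow, hB'.1.map_npow, hm] at h2
  have h3 := (abs_le.1 (hc (tY * kY ^ n * tY⁻¹ * (kY ^ n)⁻¹))).2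
  have h4 := (abs_le.1 (hc' (m ^ n * (k ^ n)⁻¹))).1
  have h5 := hle (tY * kY ^ n * tY⁻¹ * (kY ^ n)⁻¹ : orientationSubgroup G Y)
  rw [← e] at h4
  have h6 := mul_le_mul_of_nonneg_left
    (show dist y (((tY * kY ^ n * tY⁻¹ * (kY ^ n)⁻¹ : orientationSubgroup G Y) : G) • y)
      ≤ 3 * D + c by linarith) hM
  have h7 : |B' (m ^ n * (k ^ n)⁻¹)| ≤ M * (3 * D + c) + C + c' := by linarith
  have h8 := abs_le.1 h7
  have h9 : |2 * (n * B' k)| ≤ M * (3 * D + c) + C + c' + E := by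
    rw [abs_le]
    constructor <;> linarith
  rw [abs_mul, abs_mul, Nat.abs_cast, abs_two] at h9
  linarith [mul_nonneg (Nat.cast_nonneg (α := ℝ) n) (abs_nonneg (B' k))]

variable {H : Subgroup G} {ζ : GromovBoundary Y} {ξ : GromovBoundary Z} {B B' : H → ℝ}

/-- Replacing displacements by absolute values of Busemann quasi-morphisms turns orbit domination
into the hypothesis of `exists_eq_mul`. A separate `H` with two equations gives `B` and `B'` a
common domain. -/
theorem exists_busemann_eq_mul (hY : IsLineal G Y) (hZ : IsLineal G Z)
    (h : ∀ (y : Y) (z : Z), OrbitDominated G y z)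
    (hHY : H = orientationSubgroup G Y) (hHZ : H = orientationSubgroup G Z)
    (hζ : ζ ∈ limitSet G Y) (hξ : ξ ∈ limitSet G Z) (hB : IsBusemannAt ζ B)
    (hB' : IsBusemannAt ξ B') : ∃ c : ℝ, c ≠ 0 ∧ ∀ g, B g = c * B' g := by
  obtain ⟨y⟩ := hY.nonempty
  obtain ⟨z⟩ := hZ.nonempty
  obtain ⟨M, C, hM, -, hle⟩ := h y z
  obtain ⟨C₁, h1⟩ : ∃ C, ∀ g : H, |dist y ((g : G) • y) - (|B g|)| ≤ C := by
    subst hHY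
    exact hY.exists_abs_dist_sub_le hζ hB y
  obtain ⟨C₂, h2⟩ : ∃ C, ∀ g : H, |dist z ((g : G) • z) - (|B' g|)| ≤ C := by
    subst hHZ
    exact hZ.exists_abs_dist_sub_le hξ hB' z
  obtain ⟨a, ha⟩ : ∃ g, B g ≠ 0 := by
    subst hHY
    exact hY.exists_busemann_ne_zero hζ hB
  obtain ⟨b, hb⟩ : ∃ g, B' g ≠ 0 := by
    subst hHZ
    exact hZ.exists_busemann_ne_zero hξ hB'
  obtain ⟨c, hc⟩ := hB.1.exists_eq_mul hB'.1 hM (C := M * C₂ + C + C₁) (fun g => by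
    have h3 := (abs_le.1 (h1 g)).1
    have h4 := (abs_le.1 (h2 g)).2
    have h5 := mul_le_mul_of_nonneg_left
      (show dist z ((g : G) • z) ≤ |B' g| + C₂ by linarith) hM
    linarith [hle g]) hb
  refine ⟨c, ?_, hc⟩
  rintro rfl
  exact ha (by rw [hc, zero_mul])

theorem orbitDominated_of_busemann_eq_mul (hY : IsLineal G Y) (hZ : IsLineal G Z)
    (hHY : H = orientationSubgroup G Y) (hHZ : H = orientationSubgroup G Z)
    (hζ : ζ ∈ limitSet G Y) (hξ : ξ ∈ limitSet G Z) (hB : IsBusemannAt ζ B)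
    (hB' : IsBusemannAt ξ B') {c : ℝ} (hc : ∀ g, B g = c * B' g) (y : Y) (z : Z) :
    OrbitDominated G y z := by
  obtain ⟨C₁, h1⟩ : ∃ C, ∀ g : H, |dist y ((g : G) • y) - (|B g|)| ≤ C := by
    subst hHY
    exact hY.exists_abs_dist_sub_le hζ hB y
  obtain ⟨C₂, h2⟩ : ∃ C, ∀ g : H, |dist z ((g : G) • z) - (|B' g|)| ≤ C := by
    subst hHZ
    exact hZ.exists_abs_dist_sub_le hξ hB' z
  -- The estimate is first proved on `H`. Any other `g` is replaced by `g * t`, which changes the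
  -- two displacements by at most those of `t`.
  obtain ⟨t, ht⟩ := hY.exists_correction
  rw [← hHY] at ht
  have key : ∀ g ∈ H, dist y (g • y) ≤ |c| * dist z (g • z) + (|c| * C₂ + C₁) := fun g hg => by
    have h3 := (abs_le.1 (h1 ⟨g, hg⟩)).2
    have h4 := (abs_le.1 (h2 ⟨g, hg⟩)).1
    rw [hc, abs_mul] at h3
    have h5 := mul_le_mul_of_nonneg_left
      (show |B' ⟨g, hg⟩| ≤ dist z (g • z) + C₂ by linarith) (abs_nonneg c)
    simp only at h3
    linarith
  have hC₁ : 0 ≤ C₁ := (abs_nonneg _).trans (h1 1)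
  have hC₂ : 0 ≤ C₂ := (abs_nonneg _).trans (h2 1)
  refine ⟨|c|, |c| * C₂ + C₁ + |c| * dist z (t • z) + dist y (t • y), abs_nonneg c,
    by positivity, fun g => ?_⟩
  rcases ht g with hg | hg
  · have h3 : 0 ≤ |c| * dist z (t • z) := by positivity
    linarith [key g hg, dist_nonneg (x := y) (y := t • y)]
  · have h3 := key _ hg
    rw [mul_smul, mul_smul] at h3
    have h4 := dist_triangle_right y (g • y) (g • t • y)
    have h5 := dist_triangle z (g • z) (g • t • z)
    rw [dist_smul] at h4 h5
    have h6 := mul_le_mul_of_nonneg_left h5 (abs_nonneg c)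
    linarith

theorem orientationSubgroup_eq (hY : IsLineal G Y) (hZ : IsLineal G Z)
    (h : ∀ (y : Y) (z : Z), OrbitDominated G y z) (h' : ∀ (z : Z) (y : Y), OrbitDominated G z y) :
    orientationSubgroup G Y = orientationSubgroup G Z :=
  le_antisymm (orientationSubgroup_le hY hZ fun y z => h' z y)
    (orientationSubgroup_le hZ hY fun z y => h y z)

/-- The version of `exists_busemann_eq_mul` for actions preserving the orientation. -/
theorem exists_busemann_eq_mul_of_eq_top (hY : IsLineal G Y) (hZ : IsLineal G Z)
    (h : ∀ (y : Y) (z : Z), OrbitDominated G y z)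
    (hHY : orientationSubgroup G Y = ⊤) (hHZ : orientationSubgroup G Z = ⊤)
    (hζ : ζ ∈ limitSet G Y) (hξ : ξ ∈ limitSet G Z) {B B' : G → ℝ} (hB : IsBusemannAt ζ B)
    (hB' : IsBusemannAt ξ B') : ∃ c : ℝ, c ≠ 0 ∧ ∀ g, B g = c * B' g := by
  obtain ⟨c, hc, hc'⟩ := exists_busemann_eq_mul hY hZ h hHY.symm hHZ.symm hζ hξ
    hB.comp_subgroup hB'.comp_subgroup
  exact ⟨c, hc, fun g => hc' ⟨g, trivial⟩⟩

/-- Lineal actions with comparable orbits have the same orientation and proportional Busemann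
quasi-morphisms. -/
theorem lineal_comparison (hY : IsLineal G Y) (hZ : IsLineal G Z)
    (h : ∀ (y : Y) (z : Z), OrbitDominated G y z) (h' : ∀ (z : Z) (y : Y), OrbitDominated G z y) :
    (IsLinealPlus G Y ∧ IsLinealPlus G Z ∧
      ∀ ζ ∈ limitSet G Y, ∀ ξ ∈ limitSet G Z, ∀ Bβ Bγ : G → ℝ,
        IsBusemannAt ζ Bβ → IsBusemannAt ξ Bγ →
        ∃ c : ℝ, c ≠ 0 ∧ ∀ g : G, Bβ g = c * Bγ g) ∨
    (IsLinealMinus G Y ∧ IsLinealMinus G Z ∧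
      ∃ H : Subgroup G, H.index = 2 ∧ H = orientationSubgroup G Y ∧
        H = orientationSubgroup G Z ∧
        ∀ ζ ∈ limitSet G Y, ∀ ξ ∈ limitSet G Z, ∀ Bβ Bγ : H → ℝ,
          IsBusemannAt ζ Bβ → IsBusemannAt ξ Bγ →
          ∃ c : ℝ, c ≠ 0 ∧ ∀ g : H, Bβ g = c * Bγ g) := by
  have e := orientationSubgroup_eq hY hZ h h'
  by_cases ht : orientationSubgroup G Y = ⊤
  · have ht' := e ▸ ht
    exact Or.inl ⟨⟨hY, orientationSubgroup_eq_top_iff.1 ht⟩,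
      ⟨hZ, orientationSubgroup_eq_top_iff.1 ht'⟩, fun ζ hζ ξ hξ B B' hB hB' =>
      exists_busemann_eq_mul_of_eq_top hY hZ h ht ht' hζ hξ hB hB'⟩
  · have ht' := e ▸ ht
    exact Or.inr ⟨⟨hY, fun h => ht (orientationSubgroup_eq_top_iff.2 h)⟩,
      ⟨hZ, fun h => ht' (orientationSubgroup_eq_top_iff.2 h)⟩, _, hY.index_eq_two ht, rfl, e,
      fun ζ hζ ξ hξ B B' hB hB' => exists_busemann_eq_mul hY hZ h rfl e hζ hξ hB hB'⟩

end Comparison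

/-! Quasi-lines from quasi-cocycles -/

/-- A real valued quasi-cocycle of `G` twisted by a sign homomorphism. -/
structure QuasiCocycle (G : Type*) [Group G] where
  sign : G → ℝ
  sign_eq : ∀ g, sign g = 1 ∨ sign g = -1
  sign_mul : ∀ g h, sign (g * h) = sign g * sign h
  val : G → ℝ
  bound : ℝ
  val_mul : ∀ g h, |val (g * h) - val g - sign g * val h| ≤ bound

namespace QuasiCocycle

variable {G : Type*} [Group G] (c : QuasiCocycle G)

theorem sign_mul_self (g : G) : c.sign g * c.sign g = 1 := by
  rcases c.sign_eq g with h | h <;> simp [h]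

theorem sign_one : c.sign 1 = 1 := by
  have h := c.sign_mul 1 1
  rw [mul_one, c.sign_mul_self] at h
  exact h

theorem sign_inv (g : G) : c.sign g⁻¹ = c.sign g := by
  have h := c.sign_mul g⁻¹ g
  rw [inv_mul_cancel, c.sign_one] at h
  rcases c.sign_eq g with h' | h' <;> rw [h'] at h ⊢ <;> linarith

theorem abs_sign (g : G) : |c.sign g| = 1 := by
  rcases c.sign_eq g with h | h <;> simp [h]

end QuasiCocycle

/-- The space of functions on `G` that are as close to the quasi-cocycle `c` as the translates
of `c` are. -/
structure QuasiLine {G : Type u} [Group G] (c : QuasiCocycle G) : Type (max u v) where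
  toFun : G → ℝ
  abs_le : ∀ h k : G, |toFun h - toFun k - c.sign k * c.val (k⁻¹ * h)| ≤ c.bound

namespace QuasiLine

variable {G : Type u} [Group G] {c : QuasiCocycle G}

theorem ext' {f f' : QuasiLine.{u, v} c} (h : ∀ k, f.toFun k = f'.toFun k) : f = f' := by
  cases f
  cases f'
  congr
  exact funext h

/-- Both functions follow `c.val` from the point 1 up to `c.bound`, so they differ by a nearly
constant function. Hence the sup distance is finite and is governed by the values at 1. -/
theorem abs_sub_sub_le (f f' : QuasiLine.{u, v} c) (h : G) :
    |f.toFun h - f'.toFun h - (f.toFun 1 - f'.toFun 1)| ≤ 2 * c.bound := by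
  have h1 := _root_.abs_le.1 (f.abs_le h 1)
  have h2 := _root_.abs_le.1 (f'.abs_le h 1)
  rw [_root_.abs_le]
  constructor <;> linarith

theorem abs_sub_le (f f' : QuasiLine.{u, v} c) (h : G) :
    |f.toFun h - f'.toFun h| ≤ |f.toFun 1 - f'.toFun 1| + 2 * c.bound := by
  have h1 := abs_sub_abs_le_abs_sub (f.toFun h - f'.toFun h) (f.toFun 1 - f'.toFun 1)
  linarith [abs_sub_sub_le f f' h]

theorem bddAbove (f f' : QuasiLine.{u, v} c) :
    BddAbove (Set.range fun h => |f.toFun h - f'.toFun h|) :=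
  ⟨_, by rintro _ ⟨h, rfl⟩; exact abs_sub_le f f' h⟩

noncomputable instance : Dist (QuasiLine.{u, v} c) :=
  ⟨fun f f' => ⨆ h, |f.toFun h - f'.toFun h|⟩

theorem abs_sub_le_dist (f f' : QuasiLine.{u, v} c) (h : G) :
    |f.toFun h - f'.toFun h| ≤ dist f f' := le_ciSup (bddAbove f f') h

theorem dist_le_of_forall {f f' : QuasiLine.{u, v} c} {r : ℝ}
    (h : ∀ k, |f.toFun k - f'.toFun k| ≤ r) : dist f f' ≤ r := ciSup_le h

noncomputable instance : MetricSpace (QuasiLine.{u, v} c) where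
  dist_self f := by simp [dist]
  dist_comm f f' := by simp only [dist, abs_sub_comm]
  dist_triangle f f' f'' := dist_le_of_forall fun k =>
    (_root_.abs_sub_le _ (f'.toFun k) _).trans
      (add_le_add (abs_sub_le_dist _ _ _) (abs_sub_le_dist _ _ _))
  eq_of_dist_eq_zero {f f'} h := ext' fun k =>
    sub_eq_zero.1 (abs_nonpos_iff.1 (h ▸ abs_sub_le_dist f f' k))

theorem dist_le (f f' : QuasiLine.{u, v} c) :
    dist f f' ≤ |f.toFun 1 - f'.toFun 1| + 2 * c.bound := dist_le_of_forall (abs_sub_le f f')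

/-- Left translation leaves `k⁻¹ * h` unchanged and multiplies `c.sign k` by `c.sign g`; the outer
sign compensates, so the defining inequality is preserved. -/
noncomputable instance : MulAction G (QuasiLine.{u, v} c) where
  smul g f := ⟨fun h => c.sign g * f.toFun (g⁻¹ * h), fun h k => by
    have h1 := f.abs_le (g⁻¹ * h) (g⁻¹ * k)
    have h2 : (g⁻¹ * k)⁻¹ * (g⁻¹ * h) = k⁻¹ * h := by group
    rw [h2, c.sign_mul, c.sign_inv] at h1
    have h3 : c.sign g * f.toFun (g⁻¹ * h) - c.sign g * f.toFun (g⁻¹ * k)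
        - c.sign k * c.val (k⁻¹ * h) = c.sign g * (f.toFun (g⁻¹ * h) - f.toFun (g⁻¹ * k)
        - c.sign g * c.sign k * c.val (k⁻¹ * h)) := by
      linear_combination (c.sign k * c.val (k⁻¹ * h)) * c.sign_mul_self g
    rw [h3, abs_mul, c.abs_sign, one_mul]
    exact h1⟩
  one_smul f := ext' fun k => by
    change c.sign 1 * f.toFun (1⁻¹ * k) = _
    rw [c.sign_one, inv_one, one_mul, one_mul]
  mul_smul g h f := ext' fun k => by
    change c.sign (g * h) * f.toFun ((g * h)⁻¹ * k)
      = c.sign g * (c.sign h * f.toFun (h⁻¹ * (g⁻¹ * k)))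
    rw [c.sign_mul, mul_inv_rev, mul_assoc, mul_assoc]

theorem smul_toFun (g : G) (f : QuasiLine.{u, v} c) (h : G) :
    (g • f).toFun h = c.sign g * f.toFun (g⁻¹ * h) := rfl

instance : IsIsometricSMul G (QuasiLine.{u, v} c) := ⟨fun g => by
  refine Isometry.of_dist_eq fun f f' => le_antisymm (dist_le_of_forall fun k => ?_)
    (dist_le_of_forall fun k => ?_)
  · rw [smul_toFun, smul_toFun, ← mul_sub, abs_mul, c.abs_sign, one_mul]
    exact abs_sub_le_dist f f' _
  · have h := abs_sub_le_dist (g • f) (g • f') (g * k)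
    rwa [smul_toFun, smul_toFun, ← mul_sub, abs_mul, c.abs_sign, one_mul,
      inv_mul_cancel_left] at h⟩

/-- Convex combinations. -/
noncomputable def segment (f f' : QuasiLine.{u, v} c) (t : ℝ) (h0 : 0 ≤ t) (h1 : t ≤ 1) :
    QuasiLine.{u, v} c :=
  ⟨fun h => f.toFun h + t * (f'.toFun h - f.toFun h), fun h k => by
    have h2 := _root_.abs_le.1 (f.abs_le h k)
    have h3 := _root_.abs_le.1 (f'.abs_le h k)
    rw [_root_.abs_le]
    constructor <;> nlinarith⟩

/-- The real line is 0-hyperbolic: a case check on the order of the four points. -/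
theorem abs_four_point (x y z w : ℝ) :
    min ((|x - w| + |y - w| - |x - y|) / 2) ((|y - w| + |z - w| - |y - z|) / 2)
      ≤ (|x - w| + |z - w| - |x - z|) / 2 := by
  rw [min_le_iff]
  rcases abs_cases (x - w) with h1 | h1 <;> rcases abs_cases (y - w) with h2 | h2 <;>
  rcases abs_cases (z - w) with h3 | h3 <;> rcases abs_cases (x - y) with h4 | h4 <;>
  rcases abs_cases (y - z) with h5 | h5 <;> rcases abs_cases (x - z) with h6 | h6 <;>
  first
  | (left; linarith)
  | (right; linarith)

theorem gromovProduct_le (f f' w : QuasiLine.{u, v} c) :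
    gromovProduct f f' w ≤ (|f.toFun 1 - w.toFun 1| + |f'.toFun 1 - w.toFun 1|
      - |f.toFun 1 - f'.toFun 1|) / 2 + 2 * c.bound := by
  have h1 := dist_le f w
  have h2 := dist_le f' w
  have h3 := abs_sub_le_dist f f' 1
  simp only [gromovProduct]
  linarith

theorem le_gromovProduct (f f' w : QuasiLine.{u, v} c) :
    (|f.toFun 1 - w.toFun 1| + |f'.toFun 1 - w.toFun 1|
      - |f.toFun 1 - f'.toFun 1|) / 2 - c.bound ≤ gromovProduct f f' w := by
  have h1 := abs_sub_le_dist f w 1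
  have h2 := abs_sub_le_dist f' w 1
  have h3 := dist_le f f'
  simp only [gromovProduct]
  linarith

/-- Along an affine segment all pointwise differences scale by the same factor, so the supremum
scales too and segments are geodesics. Hyperbolicity is that of the line, read at 1. -/
instance : HyperbolicSpace (QuasiLine.{u, v} c) where
  geodesic f f' := by
    have hd : 0 ≤ dist f f' := dist_nonneg
    -- The parameter is clamped to `[0, 1]` because geodesics are functions on all of `ℝ`, while
    -- `segment` is only defined for such parameters.
    refine ⟨fun s => segment f f' (max 0 (min 1 (s / dist f f'))) (le_max_left _ _)
      (max_le zero_le_one (min_le_left _ _)), ?_, ?_, fun s hs t ht => ?_⟩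
    · exact ext' fun k => by simp [segment]
    · rcases hd.eq_or_lt with h | h
      · exact ext' fun k => by simp [segment, dist_eq_zero.1 h.symm]
      · exact ext' fun k => by simp [segment, div_self h.ne']
    · rcases hd.eq_or_lt with h | h
      · rw [← h, Set.Icc_self, Set.mem_singleton_iff] at hs ht
        simp [hs, ht]
      · have hpar : ∀ s ∈ Set.Icc 0 (dist f f'),
            max 0 (min 1 (s / dist f f')) = s / dist f f' := fun s hs => by
          rw [min_eq_right ((div_le_one h).2 hs.2), max_eq_right (div_nonneg hs.1 hd)]
        have e : ∀ k, |(segment f f' (max 0 (min 1 (s / dist f f'))) (le_max_left _ _)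
            (max_le zero_le_one (min_le_left _ _))).toFun k
            - (segment f f' (max 0 (min 1 (t / dist f f'))) (le_max_left _ _)
            (max_le zero_le_one (min_le_left _ _))).toFun k|
            = |s - t| / dist f f' * |f.toFun k - f'.toFun k| := fun k => by
          simp only [segment, hpar s hs, hpar t ht]
          rw [← abs_of_pos h, ← abs_div, ← abs_mul, abs_of_pos h, abs_sub_comm (_ + _)]
          congr 1
          ring
        change ⨆ k, _ = _
        simp_rw [e]
        rw [← Real.mul_iSup_of_nonneg (by positivity)]
        change |s - t| / dist f f' * dist f f' = _
        field_simp
  hyperbolic := by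
    -- Comparison with products on the line costs `2 * c.bound` from above and `c.bound` from below.
    refine ⟨3 * c.bound, fun x y z w => ?_⟩
    have h1 := gromovProduct_le x y w
    have h2 := gromovProduct_le y z w
    have h3 := le_gromovProduct x z w
    rcases min_le_iff.1 (abs_four_point (x.toFun 1) (y.toFun 1) (z.toFun 1) (w.toFun 1))
      with h | h
    · linarith [min_le_left (gromovProduct x y w) (gromovProduct y z w)]
    · linarith [min_le_right (gromovProduct x y w) (gromovProduct y z w)]

/-! The two ends of a quasi-line -/

variable (c) in
/-- The quasi-cocycle itself, shifted by a constant. -/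
def base (r : ℝ) : QuasiLine.{u, v} c := ⟨fun h => c.val h + r, fun h k => by
  have h1 := c.val_mul k (k⁻¹ * h)
  rw [mul_inv_cancel_left] at h1
  rwa [add_sub_add_right_eq_sub]⟩

theorem gromovClose_of_atTop {x y : ℕ → QuasiLine.{u, v} c}
    (hx : Tendsto (fun n => (x n).toFun 1) atTop atTop)
    (hy : Tendsto (fun n => (y n).toFun 1) atTop atTop) : GromovClose x y := by
  intro w
  refine tendsto_atTop.2 fun R => ?_
  obtain ⟨a, ha⟩ := eventually_atTop.1 (tendsto_atTop.1 hx (R + c.bound + w.toFun 1))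
  obtain ⟨b, hb⟩ := eventually_atTop.1 (tendsto_atTop.1 hy (R + c.bound + w.toFun 1))
  refine eventually_atTop.2 ⟨(a, b), fun p hp => ?_⟩
  have h1 := ha _ hp.1
  have h2 := hb _ hp.2
  have h3 := le_gromovProduct (x p.1) (y p.2) w
  have h4 := le_abs_self ((x p.1).toFun 1 - w.toFun 1)
  have h5 := le_abs_self ((y p.2).toFun 1 - w.toFun 1)
  rcases abs_cases ((x p.1).toFun 1 - (y p.2).toFun 1) with h6 | h6 <;> linarith

theorem gromovClose_of_atBot {x y : ℕ → QuasiLine.{u, v} c}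
    (hx : Tendsto (fun n => (x n).toFun 1) atTop atBot)
    (hy : Tendsto (fun n => (y n).toFun 1) atTop atBot) : GromovClose x y := by
  intro w
  refine tendsto_atTop.2 fun R => ?_
  obtain ⟨a, ha⟩ := eventually_atTop.1 (tendsto_atBot.1 hx (w.toFun 1 - R - c.bound))
  obtain ⟨b, hb⟩ := eventually_atTop.1 (tendsto_atBot.1 hy (w.toFun 1 - R - c.bound))
  refine eventually_atTop.2 ⟨(a, b), fun p hp => ?_⟩
  have h1 := ha _ hp.1
  have h2 := hb _ hp.2
  have h3 := le_gromovProduct (x p.1) (y p.2) w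
  have h4 := neg_abs_le ((x p.1).toFun 1 - w.toFun 1)
  have h5 := neg_abs_le ((y p.2).toFun 1 - w.toFun 1)
  rcases abs_cases ((x p.1).toFun 1 - (y p.2).toFun 1) with h6 | h6 <;> linarith

theorem not_gromovClose {x y : ℕ → QuasiLine.{u, v} c}
    (hx : Tendsto (fun n => (x n).toFun 1) atTop atTop)
    (hy : Tendsto (fun n => (y n).toFun 1) atTop atBot) : ¬ GromovClose x y := by
  intro h
  obtain ⟨n, ⟨h1, h2⟩, h3⟩ := (((tendsto_atTop.1 hx ((base c 0).toFun 1)).and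
    (tendsto_atBot.1 hy ((base c 0).toFun 1))).and
    (tendsto_atTop_diagonal.eventually (tendsto_atTop.1 (h (base c 0)) (2 * c.bound + 1)))).exists
  have h4 := gromovProduct_le (x n) (y n) (base c 0)
  rw [abs_of_nonneg (sub_nonneg.2 h1), abs_of_nonpos (sub_nonpos.2 h2),
    abs_of_nonneg (sub_nonneg.2 (h2.trans h1))] at h4
  simp only at h3
  linarith

/-- A large Gromov product forces the two values at 1 to lie far out on the same side of the base
value. Comparing each late term with the fixed term `x N` shows that the side never changes. -/
theorem tendsto_of_gromovClose {x : ℕ → QuasiLine.{u, v} c} (hx : GromovClose x x) :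
    Tendsto (fun n => (x n).toFun 1) atTop atTop ∨
      Tendsto (fun n => (x n).toFun 1) atTop atBot := by
  set b := (base.{u, v} c 0).toFun 1 with hb
  have key : ∀ R > 0, ∃ N, ∀ m ≥ N, ∀ n ≥ N,
      (R < (x m).toFun 1 - b ∧ R < (x n).toFun 1 - b) ∨
      ((x m).toFun 1 - b < -R ∧ (x n).toFun 1 - b < -R) := fun R hR => by
    obtain ⟨p, hp⟩ := eventually_atTop.1
      (tendsto_atTop.1 (hx (base c 0)) (R + 2 * c.bound + 1))
    refine ⟨max p.1 p.2, fun m hm n hn => ?_⟩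
    have h1 := hp (m, n) ⟨(le_max_left _ _).trans hm, (le_max_right _ _).trans hn⟩
    have h2 := gromovProduct_le (x m) (x n) (base c 0)
    rw [← hb] at h2
    simp only at h1
    rcases abs_cases ((x m).toFun 1 - b) with h3 | h3 <;>
    rcases abs_cases ((x n).toFun 1 - b) with h4 | h4 <;>
    rcases abs_cases ((x m).toFun 1 - (x n).toFun 1) with h5 | h5 <;>
    first
    | (left; constructor <;> linarith)
    | (right; constructor <;> linarith)
  obtain ⟨N, hN⟩ := key 1 one_pos
  rcases hN N le_rfl N le_rfl with h | h
  · left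
    refine tendsto_atTop.2 fun R => ?_
    obtain ⟨M, hM⟩ := key (|R| + |b| + 1) (by positivity)
    refine eventually_atTop.2 ⟨max N M, fun n hn => ?_⟩
    have h1 := hN N le_rfl n ((le_max_left _ _).trans hn)
    have h2 := hM n ((le_max_right _ _).trans hn) n ((le_max_right _ _).trans hn)
    rcases h1 with h1 | h1 <;> rcases h2 with h2 | h2 <;>
    linarith [h1.1, h1.2, h2.1, h.1, le_abs_self R, neg_abs_le b, abs_nonneg R, abs_nonneg b]
  · right
    refine tendsto_atBot.2 fun R => ?_
    obtain ⟨M, hM⟩ := key (|R| + |b| + 1) (by positivity)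
    refine eventually_atTop.2 ⟨max N M, fun n hn => ?_⟩
    have h1 := hN N le_rfl n ((le_max_left _ _).trans hn)
    have h2 := hM n ((le_max_right _ _).trans hn) n ((le_max_right _ _).trans hn)
    rcases h1 with h1 | h1 <;> rcases h2 with h2 | h2 <;>
    linarith [h1.1, h1.2, h2.1, h.1, neg_abs_le R, le_abs_self b, abs_nonneg R, abs_nonneg b]

variable (c) in
theorem tendsto_base_atTop :
    Tendsto (fun n : ℕ => (base.{u, v} c n).toFun 1) atTop atTop :=
  tendsto_atTop_add_const_left _ _ tendsto_natCast_atTop_atTop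

variable (c) in
theorem tendsto_base_atBot :
    Tendsto (fun n : ℕ => (base.{u, v} c (-n)).toFun 1) atTop atBot :=
  tendsto_atBot_add_const_left _ _ (tendsto_neg_atTop_atBot.comp tendsto_natCast_atTop_atTop)

variable (c) in
/-- The end of a quasi-line at `+∞`. -/
noncomputable def endPos : GromovBoundary (QuasiLine.{u, v} c) :=
  Quotient.mk gromovSetoid ⟨fun n => base c n,
    gromovClose_of_atTop (tendsto_base_atTop.{u, v} c) (tendsto_base_atTop.{u, v} c)⟩

variable (c) in
/-- The end of a quasi-line at `-∞`. -/
noncomputable def endNeg : GromovBoundary (QuasiLine.{u, v} c) :=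
  Quotient.mk gromovSetoid ⟨fun n => base c (-n),
    gromovClose_of_atBot (tendsto_base_atBot.{u, v} c) (tendsto_base_atBot.{u, v} c)⟩

theorem tendsToBoundary_endPos {x : ℕ → QuasiLine.{u, v} c}
    (hx : Tendsto (fun n => (x n).toFun 1) atTop atTop) : TendsToBoundary x (endPos c) :=
  TendsToBoundary.of_close ⟨_, rfl⟩ (gromovClose_of_atTop (tendsto_base_atTop.{u, v} c) hx)

theorem tendsToBoundary_endNeg {x : ℕ → QuasiLine.{u, v} c}
    (hx : Tendsto (fun n => (x n).toFun 1) atTop atBot) : TendsToBoundary x (endNeg c) :=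
  TendsToBoundary.of_close ⟨_, rfl⟩ (gromovClose_of_atBot (tendsto_base_atBot.{u, v} c) hx)

variable (c) in
theorem endPos_ne_endNeg : endPos.{u, v} c ≠ endNeg c := fun h =>
  not_gromovClose (tendsto_base_atTop.{u, v} c) (tendsto_base_atBot.{u, v} c)
    ((tendsToBoundary_endPos (tendsto_base_atTop.{u, v} c)).close
      (h ▸ tendsToBoundary_endNeg (tendsto_base_atBot.{u, v} c)))

theorem eq_endPos_or_eq_endNeg (ζ : GromovBoundary (QuasiLine.{u, v} c)) :
    ζ = endPos c ∨ ζ = endNeg c := by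
  obtain ⟨x, hx⟩ := exists_tendsToBoundary ζ
  rcases tendsto_of_gromovClose hx.self with h | h
  · exact Or.inl (hx.unique (tendsToBoundary_endPos h))
  · exact Or.inr (hx.unique (tendsToBoundary_endNeg h))

theorem smul_endPos_eq_iff {g : G} : g • endPos.{u, v} c = endPos c ↔ c.sign g = 1 := by
  have h := (tendsToBoundary_endPos (tendsto_base_atTop.{u, v} c)).smul g
  rcases c.sign_eq g with hg | hg
  · refine iff_of_true (h.unique (tendsToBoundary_endPos ?_)) hg
    simp only [smul_toFun, hg, one_mul]
    exact tendsto_atTop_add_const_left _ _ tendsto_natCast_atTop_atTop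
  · refine iff_of_false (fun h' => endPos_ne_endNeg.{u, v} c ?_) (by rw [hg]; norm_num)
    rw [← h']
    refine h.unique (tendsToBoundary_endNeg ?_)
    simp only [smul_toFun, hg, neg_one_mul]
    exact tendsto_neg_atTop_atBot.comp
      (tendsto_atTop_add_const_left _ _ tendsto_natCast_atTop_atTop)

theorem smul_endNeg_eq {g : G} (hg : c.sign g = 1) : g • endNeg.{u, v} c = endNeg c := by
  rcases eq_endPos_or_eq_endNeg (g • endNeg.{u, v} c) with h | h
  · rw [← smul_endPos_eq_iff.2 hg] at h
    exact absurd (MulAction.injective g h).symm (endPos_ne_endNeg c)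
  · exact h

/-- Computation of Busemann quasi-morphisms on a quasi-line. -/
theorem isBusemannAt_endPos {K : Type*} [Group K] [MulAction K (QuasiLine.{u, v} c)]
    [IsIsometricSMul K (QuasiLine.{u, v} c)] {B : K → ℝ} (hB : IsHomogeneousQuasimorphism B)
    (h : ∀ k : K, (k • base.{u, v} c 0).toFun 1 = B k) : IsBusemannAt (endPos.{u, v} c) B := by
  have hx := tendsToBoundary_endPos (tendsto_base_atTop.{u, v} c)
  obtain ⟨δ, hδ⟩ := exists_fourPoint (QuasiLine.{u, v} c)
  refine isBusemannAt_of_bound hB hx (w := base c 0) (C := 4 * δ + 2 * c.bound + |c.val 1|)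
    fun k => ?_
  -- The far point `base c n` lies beyond `k • base c 0`, so the absolute values open with known
  -- signs.
  obtain ⟨n, h1, h2⟩ := ((eventually_quasiHorofunction_sub hx.self hδ (k • base c 0)
    (base c 0)).and (tendsto_atTop.1 (tendsto_base_atTop.{u, v} c) (B k))).exists
  have h3 := abs_sub_le_dist (base.{u, v} c n) (base c 0) 1
  have h4 := dist_le (base.{u, v} c n) (base c 0)
  have h5 := abs_sub_le_dist (base.{u, v} c n) (k • base c 0) 1
  have h6 := dist_le (base.{u, v} c n) (k • base c 0)
  rw [h, abs_of_nonneg (sub_nonneg.2 h2)] at h5 h6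
  have h7 : (base.{u, v} c n).toFun 1 - (base.{u, v} c 0).toFun 1 = n := by simp [base]
  have h8 : (base.{u, v} c n).toFun 1 = c.val 1 + n := rfl
  rw [h7, Nat.abs_cast] at h3 h4
  rw [h8] at h5 h6
  rw [_root_.abs_le] at h1 ⊢
  constructor <;> linarith [le_abs_self (c.val 1), neg_abs_le (c.val 1)]

/-! ### Quasi-lines on which an element of sign one translates -/

section Unbounded

variable {a : G} {κ : ℝ} (hκ : κ ≠ 0) (ha : c.sign a = 1) (hval : ∀ n : ℤ, c.val (a ^ n) = n * κ)

include ha in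
theorem sign_zpow (n : ℤ) : c.sign (a ^ n) = 1 := by
  have hnat : ∀ n : ℕ, c.sign (a ^ n) = 1 := fun n => by
    induction n with
    | zero => rw [pow_zero, c.sign_one]
    | succ n ih => rw [pow_succ, c.sign_mul, ih, ha, one_mul]
  cases n with
  | ofNat n => simpa using hnat n
  | negSucc n => rw [zpow_negSucc, c.sign_inv, hnat]

include ha hval in
theorem zpow_smul_base_toFun (n : ℤ) : (a ^ n • base.{u, v} c 0).toFun 1 = -(n * κ) := by
  rw [smul_toFun, sign_zpow ha, mul_one, ← zpow_neg, one_mul]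
  change c.val (a ^ (-n)) + 0 = _
  rw [hval]
  push_cast
  ring

include hκ ha hval in
theorem isCobounded : IsCobounded fun (g : G) (x : QuasiLine.{u, v} c) => g • x := by
  refine ⟨base c 0, |κ| + 2 * c.bound, fun x => ⟨a ^ (-round (x.toFun 1 / κ)), ?_⟩⟩
  refine (dist_le _ _).trans ?_
  rw [zpow_smul_base_toFun ha hval]
  have h1 := abs_sub_round (x.toFun 1 / κ)
  have h2 : -(((-round (x.toFun 1 / κ) : ℤ) : ℝ) * κ) - x.toFun 1
      = -((x.toFun 1 / κ - round (x.toFun 1 / κ)) * κ) := by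
    push_cast
    field_simp
    ring
  rw [h2, abs_neg, abs_mul]
  nlinarith [abs_nonneg κ]

include hκ ha hval in
theorem limitSet_eq : limitSet G (QuasiLine.{u, v} c) = {endPos c, endNeg c} := by
  refine Set.Subset.antisymm (fun ζ _ => eq_endPos_or_eq_endNeg ζ) ?_
  -- The sign of `κ` decides whether `a` or `a⁻¹` moves the base towards `+∞`; `s` is 1 or -1
  -- accordingly.
  have key : ∀ s : ℤ, 0 < -(s * κ) → endPos.{u, v} c ∈ limitSet G (QuasiLine.{u, v} c) ∧
      endNeg.{u, v} c ∈ limitSet G (QuasiLine.{u, v} c) := fun s hs => by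
    have hu : Tendsto (fun n : ℕ => (n : ℝ) * -(s * κ)) atTop atTop :=
      tendsto_natCast_atTop_atTop.atTop_mul_const hs
    refine ⟨⟨base c 0, fun n => a ^ ((n : ℤ) * s), tendsToBoundary_endPos (hu.congr fun n => ?_)⟩,
      ⟨base c 0, fun n => a ^ (-((n : ℤ) * s)), tendsToBoundary_endNeg
        ((tendsto_neg_atTop_atBot.comp hu).congr fun n => ?_)⟩⟩
    · rw [zpow_smul_base_toFun ha hval]
      push_cast
      ring
    · rw [zpow_smul_base_toFun ha hval, Function.comp]
      push_cast
      ring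
  have : endPos.{u, v} c ∈ limitSet G (QuasiLine.{u, v} c) ∧
      endNeg.{u, v} c ∈ limitSet G (QuasiLine.{u, v} c) := by
    rcases hκ.lt_or_gt with h | h
    · exact key 1 (by simpa using h)
    · exact key (-1) (by simpa using h)
  rintro ζ (rfl | rfl)
  exacts [this.1, this.2]

include hκ ha hval in
theorem isLineal : IsLineal G (QuasiLine.{u, v} c) := by
  rw [IsLineal, limitSet_eq hκ ha hval]
  exact Set.encard_pair (endPos_ne_endNeg c)

include hκ ha hval in
theorem mem_orientationSubgroup_iff {g : G} :
    g ∈ orientationSubgroup G (QuasiLine.{u, v} c) ↔ c.sign g = 1 := by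
  rw [orientationSubgroup, mem_fixingSubgroup_iff, limitSet_eq hκ ha hval]
  refine ⟨fun h => smul_endPos_eq_iff.1 (h (endPos c) (Or.inl rfl)), fun h => ?_⟩
  rintro ζ (rfl | rfl)
  exacts [smul_endPos_eq_iff.2 h, smul_endNeg_eq h]

end Unbounded

end QuasiLine

/-- The constant sign quasi-cocycle of a homogeneous quasi-morphism. -/
theorem exists_quasiCocycle {G : Type*} [Group G] {q : G → ℝ}
    (hq : IsHomogeneousQuasimorphism q) :
    ∃ c : QuasiCocycle G, (∀ g, c.sign g = 1) ∧ ∀ g, c.val g = q g := by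
  obtain ⟨⟨D, hD⟩, -⟩ := hq
  exact ⟨⟨fun _ => 1, fun _ => Or.inl rfl, fun _ _ => (one_mul 1).symm, q, D,
    fun g h => by rw [one_mul]; exact hD g h⟩, fun _ => rfl, fun _ => rfl⟩

/-- An antisymmetric homogeneous quasi-morphism of a subgroup of index two extends to a twisted
quasi-cocycle. -/
theorem exists_quasiCocycle_of_antisymmetric {G : Type*} [Group G] {H : Subgroup G}
    (hH : H.index = 2) {q : H → ℝ} (hq : q ∈ antisymmetricQuasimorphisms H) :
    ∃ c : QuasiCocycle G, (∀ g, c.sign g = 1 ↔ g ∈ H) ∧ ∀ g : H, c.val g = q g := by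
  classical
  obtain ⟨⟨⟨D, hD⟩, -⟩, hanti⟩ := hq
  have hmul : ∀ {a b : G}, a * b ∈ H ↔ (a ∈ H ↔ b ∈ H) :=
    fun {a b} => Subgroup.mul_mem_iff_of_index_two hH
  obtain ⟨t, ht⟩ : ∃ t, t ∉ H := by
    by_contra! h
    rw [(Subgroup.eq_top_iff' H).2 h, Subgroup.index_top] at hH
    omega
  have hti : t⁻¹ ∉ H := fun h => ht (H.inv_mem_iff.1 h)
  have hright : ∀ {g : G}, g ∉ H → g * t⁻¹ ∈ H := fun {g} hg => hmul.2 (iff_of_false hg hti)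
  have htt : t * t ∈ H := hmul.2 Iff.rfl
  have hconj : ∀ {g : G}, g ∈ H → t * g * t⁻¹ ∈ H := fun {g} hg =>
    hright fun h => ht ((hmul.1 h).2 hg)
  -- The element `t * t` is its own conjugate under `t`, so antisymmetry makes `q` vanish on it.
  have htt0 : q ⟨t * t, htt⟩ = 0 := by
    have := hanti t ht ⟨t * t, htt⟩ ⟨t * t, htt⟩ (by group)
    linarith
  have hD0 : 0 ≤ D := (abs_nonneg _).trans (hD 1 1)
  -- The extension is normalised to vanish at `t`, up to the value of `q` at 1, and is carried to
  -- the other coset by right multiplication by `t`.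
  let a : G → ℝ := fun g => if hg : g ∈ H then q ⟨g, hg⟩ else q ⟨g * t⁻¹, hright hg⟩
  have ha : ∀ {g : G} (hg : g ∈ H), a g = q ⟨g, hg⟩ := fun hg => dif_pos hg
  have ha' : ∀ {g : G} (hg : g ∉ H), a g = q ⟨g * t⁻¹, hright hg⟩ := fun hg => dif_neg hg
  refine ⟨⟨fun g => if g ∈ H then 1 else -1, fun g => ?_, fun g h => ?_, a, 2 * D,
    fun g h => ?_⟩, fun g => ?_, fun g => ha g.2⟩
  · by_cases hg : g ∈ H <;> simp [hg]
  · by_cases hg : g ∈ H <;> by_cases hh : h ∈ H <;> simp [hg, hh, hmul]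
  · by_cases hg : g ∈ H <;> by_cases hh : h ∈ H
    · rw [ha hg, ha hh, ha (H.mul_mem hg hh), if_pos hg, one_mul]
      have := hD ⟨g, hg⟩ ⟨h, hh⟩
      exact this.trans (by linarith)
    · have hgh : g * h ∉ H := fun h' => hh ((hmul.1 h').1 hg)
      rw [ha hg, ha' hh, ha' hgh, if_pos hg, one_mul]
      have h1 := hD ⟨g, hg⟩ ⟨h * t⁻¹, hright hh⟩
      have e : (⟨g, hg⟩ : H) * ⟨h * t⁻¹, hright hh⟩ = ⟨g * h * t⁻¹, hright hgh⟩ :=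
        Subtype.ext (mul_assoc _ _ _).symm
      rw [e] at h1
      exact h1.trans (by linarith)
    · have hgh : g * h ∉ H := fun h' => hg ((hmul.1 h').2 hh)
      rw [ha' hg, ha hh, ha' hgh, if_neg hg]
      have h1 := hD ⟨g * t⁻¹, hright hg⟩ ⟨t * h * t⁻¹, hconj hh⟩
      have e : (⟨g * t⁻¹, hright hg⟩ : H) * ⟨t * h * t⁻¹, hconj hh⟩
          = ⟨g * h * t⁻¹, hright hgh⟩ := Subtype.ext (by simp [mul_assoc])
      rw [e, hanti t ht ⟨h, hh⟩ ⟨t * h * t⁻¹, hconj hh⟩ rfl] at h1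
      rw [neg_one_mul]
      exact h1.trans (by linarith)
    · have hgh : g * h ∈ H := hmul.2 (iff_of_false hg hh)
      rw [ha' hg, ha' hh, ha hgh, if_neg hg]
      -- Here `g * h = (g * t⁻¹) * (t * (h * t⁻¹) * t⁻¹) * (t * t)`. The middle factor produces the
      -- twisting sign and the last contributes 0; the two products account for the bound `2 * D`.
      have h1 := abs_le.1
        (hD ⟨g * t⁻¹, hright hg⟩ (⟨t * (h * t⁻¹) * t⁻¹, hconj (hright hh)⟩ * ⟨t * t, htt⟩))
      have h2 := abs_le.1 (hD ⟨t * (h * t⁻¹) * t⁻¹, hconj (hright hh)⟩ ⟨t * t, htt⟩)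
      have e : (⟨g * t⁻¹, hright hg⟩ : H)
          * (⟨t * (h * t⁻¹) * t⁻¹, hconj (hright hh)⟩ * ⟨t * t, htt⟩) = ⟨g * h, hgh⟩ :=
        Subtype.ext (by simp [mul_assoc])
      rw [e] at h1
      rw [htt0, hanti t ht ⟨h * t⁻¹, hright hh⟩ ⟨t * (h * t⁻¹) * t⁻¹, hconj (hright hh)⟩ rfl]
        at h2
      rw [abs_le]
      constructor <;> linarith
  · by_cases hg : g ∈ H <;> simp [hg]
    norm_num

/-! The classification -/

section Classification

variable {G : Type u} [Group G]

/-- The class `p` is represented by every Busemann quasi-morphism of the action on `X`. -/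
def IsBusemannClass (X : Type w) [MetricSpace X] [HyperbolicSpace X] [MulAction G X]
    [IsIsometricSMul G X] (p : ProjectiveQuasimorphisms G) : Prop :=
  (IsLinealPlus G X → ∀ ζ ∈ limitSet G X, ∀ B : G → ℝ, IsBusemannAt ζ B →
    ∃ (hB : B ∈ homogeneousQuasimorphisms G)
      (hB0 : (⟨B, hB⟩ : homogeneousQuasimorphisms G) ≠ 0),
      p = Sum.inl (Projectivization.mk ℝ ⟨B, hB⟩ hB0)) ∧
  (IsLinealMinus G X → ∀ H : Subgroup G, H = orientationSubgroup G X →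
    ∀ ζ ∈ limitSet G X, ∀ B : H → ℝ, IsBusemannAt ζ B →
      ∃ (hH : H.index = 2) (hB : B ∈ antisymmetricQuasimorphisms H)
        (hB0 : (⟨B, hB⟩ : antisymmetricQuasimorphisms H) ≠ 0),
        p = Sum.inr ⟨⟨H, hH⟩, Projectivization.mk ℝ ⟨B, hB⟩ hB0⟩)

theorem mk_eq_mk_of_eq_mul {α : Type*} {S : Submodule ℝ (α → ℝ)} {B B' : α → ℝ} {hB : B ∈ S}
    {hB' : B' ∈ S} {h0 : (⟨B, hB⟩ : S) ≠ 0} {h0' : (⟨B', hB'⟩ : S) ≠ 0} {c : ℝ}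
    (h : ∀ g, B g = c * B' g) :
    Projectivization.mk ℝ (⟨B, hB⟩ : S) h0 = Projectivization.mk ℝ ⟨B', hB'⟩ h0' :=
  (Projectivization.mk_eq_mk_iff' ℝ _ _ _ _).2 ⟨c, Subtype.ext (funext fun g => (h g).symm)⟩

theorem exists_eq_mul_of_mk_eq_mk {α : Type*} {S : Submodule ℝ (α → ℝ)} {B B' : α → ℝ}
    {hB : B ∈ S} {hB' : B' ∈ S} {h0 : (⟨B, hB⟩ : S) ≠ 0} {h0' : (⟨B', hB'⟩ : S) ≠ 0}
    (h : Projectivization.mk ℝ (⟨B, hB⟩ : S) h0 = Projectivization.mk ℝ ⟨B', hB'⟩ h0') :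
    ∃ c : ℝ, ∀ g, B g = c * B' g := by
  obtain ⟨c, hc⟩ := (Projectivization.mk_eq_mk_iff' ℝ _ _ _ _).1 h
  exact ⟨c, fun g => (congrFun (congrArg Subtype.val hc) g).symm⟩

theorem IsLineal.plus_or_minus {X : Type*} [MetricSpace X] [HyperbolicSpace X] [MulAction G X]
    [IsIsometricSMul G X] (hL : IsLineal G X) : IsLinealPlus G X ∨ IsLinealMinus G X := by
  by_cases h : ∀ ζ ∈ limitSet G X, ∀ g : G, g • ζ = ζ
  exacts [Or.inl ⟨hL, h⟩, Or.inr ⟨hL, h⟩]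

theorem orbitDominated_self {X : Type*} [MetricSpace X] [MulAction G X] [IsIsometricSMul G X]
    (x y : X) : OrbitDominated G x y := by
  refine ⟨1, 2 * dist x y, zero_le_one, by positivity, fun g => ?_⟩
  have := dist_triangle4_right x (g • x) y (g • y)
  rw [dist_smul] at this
  linarith

/-- Independence of the limit point is the comparison of `X` with itself: any two Busemann
quasi-morphisms of one action are proportional. -/
theorem exists_isBusemannClass (X : Type*) [MetricSpace X] [HyperbolicSpace X] [MulAction G X]
    [IsIsometricSMul G X] (hL : IsLineal G X) : ∃ p, IsBusemannClass (G := G) X p := by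
  obtain ⟨ζ, hζ, -⟩ := hL.exists_ne
  rcases hL.plus_or_minus with h | h
  · have ht : orientationSubgroup G X = ⊤ := orientationSubgroup_eq_top_iff.2 h.2
    have hne : ∀ {ξ}, ξ ∈ limitSet G X → ∀ {B : G → ℝ} (hB : IsBusemannAt ξ B),
        (⟨B, hB.1⟩ : homogeneousQuasimorphisms G) ≠ 0 := fun hξ B hB h0 => by
      obtain ⟨g, hg⟩ := hL.exists_busemann_ne_zero hξ hB.comp_subgroup
      exact hg (congrFun (congrArg Subtype.val h0) (g : G))
    obtain ⟨B, hB⟩ := exists_isBusemannAt (h.2 ζ hζ)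
    refine ⟨Sum.inl (Projectivization.mk ℝ ⟨B, hB.1⟩ (hne hζ hB)), fun _ ξ hξ B' hB' =>
      ⟨hB'.1, hne hξ hB', congrArg Sum.inl ?_⟩, fun h' => absurd h.2 h'.2⟩
    obtain ⟨c, -, hc⟩ := exists_busemann_eq_mul_of_eq_top hL hL orbitDominated_self ht ht hζ hξ
      hB hB'
    exact mk_eq_mk_of_eq_mul hc
  · have hi := hL.index_eq_two fun ht => h.2 (orientationSubgroup_eq_top_iff.1 ht)
    have hmem : ∀ {ξ}, ξ ∈ limitSet G X → ∀ {B : orientationSubgroup G X → ℝ},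
        IsBusemannAt ξ B → B ∈ antisymmetricQuasimorphisms (orientationSubgroup G X) :=
      fun hξ B hB => ⟨hB.1, fun t ht k k' e => hL.busemann_conj_eq_neg hξ hB ht e⟩
    have hne : ∀ {ξ}, (hξ : ξ ∈ limitSet G X) → ∀ {B : orientationSubgroup G X → ℝ}
        (hB : IsBusemannAt ξ B),
        (⟨B, hmem hξ hB⟩ : antisymmetricQuasimorphisms (orientationSubgroup G X)) ≠ 0 :=
      fun hξ B hB h0 => by
      obtain ⟨g, hg⟩ := hL.exists_busemann_ne_zero hξ hB
      exact hg (congrFun (congrArg Subtype.val h0) g)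
    obtain ⟨B, hB⟩ := exists_isBusemannAt_subgroup (smul_eq_of_mem_orientationSubgroup hζ)
    refine ⟨Sum.inr ⟨⟨_, hi⟩, Projectivization.mk ℝ ⟨B, hmem hζ hB⟩ (hne hζ hB)⟩,
      fun h' => absurd h'.2 h.2, ?_⟩
    rintro - _ rfl ξ hξ B' hB'
    obtain ⟨c, -, hc⟩ := exists_busemann_eq_mul hL hL orbitDominated_self rfl rfl hζ hξ hB hB'
    refine ⟨hi, hmem hξ hB', hne hξ hB', ?_⟩
    rw [mk_eq_mk_of_eq_mul hc]

section Equivalence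

variable {Y : Type*} [MetricSpace Y] [HyperbolicSpace Y] [MulAction G Y] [IsIsometricSMul G Y]
  {Z : Type*} [MetricSpace Z] [HyperbolicSpace Z] [MulAction G Z] [IsIsometricSMul G Z]
  {p : ProjectiveQuasimorphisms G}

/-- This carries the injectivity of the classification. Equal classes exclude mixed orientations,
since the summands are disjoint, and otherwise give proportional quasi-morphisms. -/
theorem IsBusemannClass.orbitDominated (hY : IsLineal G Y) (hZ : IsLineal G Z)
    (hpY : IsBusemannClass Y p) (hpZ : IsBusemannClass Z p) (y : Y) (z : Z) :
    OrbitDominated G y z := by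
  obtain ⟨ζ, hζ, -⟩ := hY.exists_ne
  obtain ⟨ξ, hξ, -⟩ := hZ.exists_ne
  rcases hY.plus_or_minus with h | h <;> rcases hZ.plus_or_minus with h' | h'
  · obtain ⟨B, hB⟩ := exists_isBusemannAt (h.2 ζ hζ)
    obtain ⟨B', hB'⟩ := exists_isBusemannAt (h'.2 ξ hξ)
    obtain ⟨_, _, e⟩ := hpY.1 h ζ hζ B hB
    obtain ⟨_, _, e'⟩ := hpZ.1 h' ξ hξ B' hB'
    obtain ⟨c, hc⟩ := exists_eq_mul_of_mk_eq_mk (Sum.inl.inj (e.symm.trans e'))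
    exact orbitDominated_of_busemann_eq_mul (H := ⊤) hY hZ
      (orientationSubgroup_eq_top_iff.2 h.2).symm (orientationSubgroup_eq_top_iff.2 h'.2).symm
      hζ hξ hB.comp_subgroup hB'.comp_subgroup (fun g => hc g) y z
  · obtain ⟨B, hB⟩ := exists_isBusemannAt (h.2 ζ hζ)
    obtain ⟨B', hB'⟩ := exists_isBusemannAt_subgroup (smul_eq_of_mem_orientationSubgroup hξ)
    obtain ⟨_, _, e⟩ := hpY.1 h ζ hζ B hB
    obtain ⟨_, _, _, e'⟩ := hpZ.2 h' _ rfl ξ hξ B' hB'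
    exact absurd (e.symm.trans e') Sum.inl_ne_inr
  · obtain ⟨B, hB⟩ := exists_isBusemannAt_subgroup (smul_eq_of_mem_orientationSubgroup hζ)
    obtain ⟨B', hB'⟩ := exists_isBusemannAt (h'.2 ξ hξ)
    obtain ⟨_, _, _, e⟩ := hpY.2 h _ rfl ζ hζ B hB
    obtain ⟨_, _, e'⟩ := hpZ.1 h' ξ hξ B' hB'
    exact absurd (e'.symm.trans e) Sum.inl_ne_inr
  · obtain ⟨B, hB⟩ := exists_isBusemannAt_subgroup (smul_eq_of_mem_orientationSubgroup hζ)
    obtain ⟨_, _, _, e⟩ := hpY.2 h _ rfl ζ hζ B hB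
    have hH : orientationSubgroup G Y = orientationSubgroup G Z := by
      obtain ⟨B', hB'⟩ := exists_isBusemannAt_subgroup (smul_eq_of_mem_orientationSubgroup hξ)
      obtain ⟨_, _, _, e'⟩ := hpZ.2 h' _ rfl ξ hξ B' hB'
      exact congrArg (fun s => s.1.1) (Sum.inr.inj (e.symm.trans e'))
    -- `B'` is chosen afresh on the orientation subgroup of `Y`, so that both classes live over
    -- literally the same subgroup and no transport along `hH` is needed.
    obtain ⟨B', hB'⟩ := exists_isBusemannAt_subgroup (K := orientationSubgroup G Y)
      (hH ▸ smul_eq_of_mem_orientationSubgroup hξ)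
    obtain ⟨_, _, _, e'⟩ := hpZ.2 h' _ hH ξ hξ B' hB'
    obtain ⟨c, hc⟩ := exists_eq_mul_of_mk_eq_mk
      (eq_of_heq (Sigma.mk.inj (Sum.inr.inj (e.symm.trans e'))).2)
    exact orbitDominated_of_busemann_eq_mul hY hZ rfl hH hζ hξ hB hB' hc y z

theorem IsBusemannClass.eq_of_orbitDominated (hY : IsLineal G Y) (hZ : IsLineal G Z)
    {p' : ProjectiveQuasimorphisms G} (hpY : IsBusemannClass Y p) (hpZ : IsBusemannClass Z p')
    (h : ∀ (y : Y) (z : Z), OrbitDominated G y z) (h' : ∀ (z : Z) (y : Y), OrbitDominated G z y) :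
    p = p' := by
  obtain ⟨ζ, hζ, -⟩ := hY.exists_ne
  obtain ⟨ξ, hξ, -⟩ := hZ.exists_ne
  rcases lineal_comparison hY hZ h h' with ⟨h₁, h₂, hc⟩ | ⟨h₁, h₂, H, -, hHY, hHZ, hc⟩
  · obtain ⟨B, hB⟩ := exists_isBusemannAt (h₁.2 ζ hζ)
    obtain ⟨B', hB'⟩ := exists_isBusemannAt (h₂.2 ξ hξ)
    obtain ⟨_, _, rfl⟩ := hpY.1 h₁ ζ hζ B hB
    obtain ⟨_, _, rfl⟩ := hpZ.1 h₂ ξ hξ B' hB'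
    obtain ⟨c, -, hc⟩ := hc ζ hζ ξ hξ B B' hB hB'
    rw [mk_eq_mk_of_eq_mul hc]
  · obtain ⟨B, hB⟩ := exists_isBusemannAt_subgroup (K := H)
      (hHY ▸ smul_eq_of_mem_orientationSubgroup hζ)
    obtain ⟨B', hB'⟩ := exists_isBusemannAt_subgroup (K := H)
      (hHZ ▸ smul_eq_of_mem_orientationSubgroup hξ)
    obtain ⟨_, _, _, rfl⟩ := hpY.2 h₁ H hHY ζ hζ B hB
    obtain ⟨_, _, _, rfl⟩ := hpZ.2 h₂ H hHZ ξ hξ B' hB'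
    obtain ⟨c, -, hc⟩ := hc ζ hζ ξ hξ B B' hB hB'
    rw [mk_eq_mk_of_eq_mul hc]

end Equivalence

/-- Every class of homogeneous quasi-morphisms is the Busemann class of a quasi-line. -/
theorem exists_quasiLine_of_homogeneous {q : G → ℝ} (hq : q ∈ homogeneousQuasimorphisms G)
    (hq0 : (⟨q, hq⟩ : homogeneousQuasimorphisms G) ≠ 0) :
    ∃ c : QuasiCocycle G, IsCobounded (fun (g : G) (x : QuasiLine.{u, v} c) => g • x) ∧
      IsLineal G (QuasiLine.{u, v} c) ∧
      ∀ p, IsBusemannClass (G := G) (QuasiLine.{u, v} c) p →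
        p = Sum.inl (Projectivization.mk ℝ ⟨q, hq⟩ hq0) := by
  have hq' : IsHomogeneousQuasimorphism q := hq
  obtain ⟨a, ha⟩ : ∃ a, q a ≠ 0 := by
    by_contra! h
    exact hq0 (Subtype.ext (funext h))
  obtain ⟨c, hsign, hval⟩ := exists_quasiCocycle hq'
  have hval' : ∀ n : ℤ, c.val (a ^ n) = n * q a := fun n => by rw [hval, hq'.2]
  have hL := QuasiLine.isLineal.{u, v} ha (hsign a) hval'
  refine ⟨c, QuasiLine.isCobounded ha (hsign a) hval', hL, fun p hp => ?_⟩
  have ht : orientationSubgroup G (QuasiLine.{u, v} c) = ⊤ :=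
    (Subgroup.eq_top_iff' _).2 fun g =>
      (QuasiLine.mem_orientationSubgroup_iff ha (hsign a) hval').2 (hsign g)
  have hmem : QuasiLine.endPos.{u, v} c ∈ limitSet G (QuasiLine.{u, v} c) := by
    rw [QuasiLine.limitSet_eq ha (hsign a) hval']
    exact Or.inl rfl
  -- Translating by `g` evaluates `q` at `g⁻¹`, so the quasi-morphism at `+∞` is `-q`; it has the
  -- same projective class.
  obtain ⟨_, _, rfl⟩ := hp.1 ⟨hL, orientationSubgroup_eq_top_iff.1 ht⟩ _ hmem
    (fun g => -q g) (QuasiLine.isBusemannAt_endPos hq'.neg fun g => by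
      rw [QuasiLine.smul_toFun, hsign, mul_one, one_mul]
      simp [QuasiLine.base, hval, hq'.map_inv])
  exact congrArg Sum.inl (mk_eq_mk_of_eq_mul (c := -1) fun g => by ring)

/-- Every class of antisymmetric homogeneous quasi-morphisms of a subgroup of index two is the
Busemann class of a quasi-line. -/
theorem exists_quasiLine_of_antisymmetric {H : Subgroup G} (hH : H.index = 2) {q : H → ℝ}
    (hq : q ∈ antisymmetricQuasimorphisms H)
    (hq0 : (⟨q, hq⟩ : antisymmetricQuasimorphisms H) ≠ 0) :
    ∃ c : QuasiCocycle G, IsCobounded (fun (g : G) (x : QuasiLine.{u, v} c) => g • x) ∧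
      IsLineal G (QuasiLine.{u, v} c) ∧
      ∀ p, IsBusemannClass (G := G) (QuasiLine.{u, v} c) p →
        p = Sum.inr ⟨⟨H, hH⟩, Projectivization.mk ℝ ⟨q, hq⟩ hq0⟩ := by
  have hq' : IsHomogeneousQuasimorphism q := hq.1
  obtain ⟨a, ha⟩ : ∃ a, q a ≠ 0 := by
    by_contra! h
    exact hq0 (Subtype.ext (funext h))
  obtain ⟨c, hsign, hval⟩ := exists_quasiCocycle_of_antisymmetric hH hq
  have ha1 := (hsign a).2 a.2
  have hval' : ∀ n : ℤ, c.val ((a : G) ^ n) = n * q a := fun n => by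
    rw [← Subgroup.coe_zpow, hval, hq'.2]
  have hL := QuasiLine.isLineal.{u, v} ha ha1 hval'
  refine ⟨c, QuasiLine.isCobounded ha ha1 hval', hL, fun p hp => ?_⟩
  have hor : H = orientationSubgroup G (QuasiLine.{u, v} c) := Subgroup.ext fun g =>
    (hsign g).symm.trans (QuasiLine.mem_orientationSubgroup_iff ha ha1 hval').symm
  have hm : IsLinealMinus G (QuasiLine.{u, v} c) := by
    refine ⟨hL, fun h => ?_⟩
    rw [← orientationSubgroup_eq_top_iff, ← hor] at h
    rw [h, Subgroup.index_top] at hH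
    omega
  have hmem : QuasiLine.endPos.{u, v} c ∈ limitSet G (QuasiLine.{u, v} c) := by
    rw [QuasiLine.limitSet_eq ha ha1 hval']
    exact Or.inl rfl
  obtain ⟨_, h1, h2, rfl⟩ := hp.2 hm H hor _ hmem
    (fun g => -q g) (QuasiLine.isBusemannAt_endPos hq'.neg fun g => by
      have h1 := hval g⁻¹
      rw [Subgroup.coe_inv] at h1
      rw [Subgroup.smul_def, QuasiLine.smul_toFun, (hsign g).2 g.2, mul_one, one_mul]
      simp [QuasiLine.base, h1, hq'.map_inv])
  rw [mk_eq_mk_of_eq_mul (B := fun g => -q g) (B' := q) (hB' := hq) (h0' := hq0) (c := -1)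
    fun g => by ring]

/-- Every class is the Busemann class of a cobounded lineal action. -/
theorem exists_action_of_class (p : ProjectiveQuasimorphisms G) :
    ∃ A : CoboundedLinealAction.{u, v} G, ∀ p', IsBusemannClass (G := G) A.1.space p' →
      p' = p := by
  rcases p with p | ⟨⟨H, hH⟩, p⟩
  · induction p using Projectivization.ind with
    | h q hq0 =>
      obtain ⟨c, hc, hL, h⟩ := exists_quasiLine_of_homogeneous.{u, v} q.2 hq0
      exact ⟨⟨{ space := QuasiLine.{u, v} c }, hc, hL⟩, h⟩
  · induction p using Projectivization.ind with
    | h q hq0 =>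
      obtain ⟨c, hc, hL, h⟩ := exists_quasiLine_of_antisymmetric.{u, v} hH q.2 hq0
      exact ⟨⟨{ space := QuasiLine.{u, v} c }, hc, hL⟩, h⟩

end Classification

theorem mainTheorem9 (G : Type u) [Group G] :
    -- Busemann quasi-morphisms exist and depend only on the fixed boundary point.
    (∀ (H : Type u) [Group H] (X : Type v) [MetricSpace X] [HyperbolicSpace X] [MulAction H X]
        [IsIsometricSMul H X] (ζ : GromovBoundary X), (∀ g : H, g • ζ = ζ) →
        ∃! B : H → ℝ, IsBusemannAt ζ B) ∧
    -- Any two lineal reductions of a quasi-action have the same orientation and the same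
    -- Busemann quasi-morphism up to scaling.
    (∀ (X : Type w) [MetricSpace X] (α : G → X → X), IsQuasiAction α →
      ∀ (Y : Type v) [MetricSpace Y] [HyperbolicSpace Y] [MulAction G Y] [IsIsometricSMul G Y]
        (Z : Type v') [MetricSpace Z] [HyperbolicSpace Z] [MulAction G Z] [IsIsometricSMul G Z],
        IsLineal G Y → IsLineal G Z →
        ReducesTo α (fun (g : G) (y : Y) => g • y) →
        ReducesTo α (fun (g : G) (z : Z) => g • z) →
        -- both of type (3)⁺, and the quasi-morphisms are defined on `G`
        (IsLinealPlus G Y ∧ IsLinealPlus G Z ∧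
          ∀ ζ ∈ limitSet G Y, ∀ ξ ∈ limitSet G Z, ∀ Bβ Bγ : G → ℝ,
            IsBusemannAt ζ Bβ → IsBusemannAt ξ Bγ →
            ∃ c : ℝ, c ≠ 0 ∧ ∀ g : G, Bβ g = c * Bγ g) ∨
        -- both of type (3)⁻ with the same orientation preserving subgroup `H`, of index two,
        -- and the quasi-morphisms are defined on `H`
        (IsLinealMinus G Y ∧ IsLinealMinus G Z ∧
          ∃ H : Subgroup G, H.index = 2 ∧ H = orientationSubgroup G Y ∧
            H = orientationSubgroup G Z ∧
            ∀ ζ ∈ limitSet G Y, ∀ ξ ∈ limitSet G Z, ∀ Bβ Bγ : H → ℝ,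
              IsBusemannAt ζ Bβ → IsBusemannAt ξ Bγ →
              ∃ c : ℝ, c ≠ 0 ∧ ∀ g : H, Bβ g = c * Bγ g)) ∧
    -- Classification: the projective class of the Busemann quasi-morphism induces a bijection
    -- from cobounded lineal actions up to equivalence.
    (∃ Φ : CoboundedLinealAction.{u, v} G → ProjectiveQuasimorphisms G,
      (∀ A : CoboundedLinealAction.{u, v} G, IsLinealPlus G A.1.space →
        ∀ ζ ∈ limitSet G A.1.space, ∀ B : G → ℝ, IsBusemannAt ζ B →
          ∃ (hB : B ∈ homogeneousQuasimorphisms G)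
            (hB0 : (⟨B, hB⟩ : homogeneousQuasimorphisms G) ≠ 0),
            Φ A = Sum.inl (Projectivization.mk ℝ ⟨B, hB⟩ hB0)) ∧
      (∀ A : CoboundedLinealAction.{u, v} G, IsLinealMinus G A.1.space →
        ∀ H : Subgroup G, H = orientationSubgroup G A.1.space →
        ∀ ζ ∈ limitSet G A.1.space, ∀ B : H → ℝ, IsBusemannAt ζ B →
          ∃ (hH : H.index = 2) (hB : B ∈ antisymmetricQuasimorphisms H)
            (hB0 : (⟨B, hB⟩ : antisymmetricQuasimorphisms H) ≠ 0),
            Φ A = Sum.inr ⟨⟨H, hH⟩, Projectivization.mk ℝ ⟨B, hB⟩ hB0⟩) ∧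
      (∀ A A' : CoboundedLinealAction.{u, v} G, Φ A = Φ A' ↔
        AreEquivalent (fun (g : G) (x : A.1.space) => g • x)
          (fun (g : G) (x : A'.1.space) => g • x)) ∧
      Function.Surjective Φ) := by
  refine ⟨fun H _ X _ _ _ _ ζ hζ => ?_, fun X _ α hα Y _ _ _ _ Z _ _ _ _ hY hZ hαY hαZ => ?_, ?_⟩
  · obtain ⟨B, hB⟩ := exists_isBusemannAt hζ
    exact ⟨B, hB, fun B' hB' => hB'.unique hB⟩
  · exact lineal_comparison hY hZ (orbitDominated_of_reducesTo hα hαY hαZ)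
      (orbitDominated_of_reducesTo hα hαZ hαY)
  · choose Φ hΦ using fun A : CoboundedLinealAction.{u, v} G =>
      exists_isBusemannClass (G := G) A.1.space A.2.2
    refine ⟨Φ, fun A => (hΦ A).1, fun A => (hΦ A).2, fun A A' => ⟨fun h => ?_, fun h => ?_⟩,
      fun p => ?_⟩
    · obtain ⟨y, hy⟩ := A.2.1
      obtain ⟨z, hz⟩ := A'.2.1
      exact areEquivalent_of_orbitDominated hy hz
        ((hΦ A).orbitDominated A.2.2 A'.2.2 (h ▸ hΦ A') y z)
        (IsBusemannClass.orbitDominated A'.2.2 A.2.2 (hΦ A') (h ▸ hΦ A) z y)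
    -- An equivalence makes the action on `A'` a quasi-action that reduces both to itself, by the
    -- identity, and to `A`, by `F`. The comparison of reductions then applies without inverting
    -- `F`.
    · have hid : ReducesTo (fun (g : G) (x : A'.1.space) => g • x)
          (fun (g : G) (x : A'.1.space) => g • x) :=
        ⟨id, ⟨1, 0, le_rfl, le_rfl, fun x y => by simp⟩, 0, le_rfl, fun x g => by simp⟩
      have hF : ReducesTo (fun (g : G) (x : A'.1.space) => g • x)
          (fun (g : G) (x : A.1.space) => g • x) := by
        obtain ⟨F, ⟨K, ε, C, hF, -⟩, hFe⟩ := h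
        exact ⟨F, ⟨K, ε, hF⟩, hFe⟩
      exact IsBusemannClass.eq_of_orbitDominated A.2.2 A'.2.2 (hΦ A) (hΦ A')
        (orbitDominated_of_reducesTo isQuasiAction_smul hF hid)
        (orbitDominated_of_reducesTo isQuasiAction_smul hid hF)
    · obtain ⟨A, hA⟩ := exists_action_of_class.{u, v} p
      exact ⟨A, hA _ (hΦ A)⟩
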